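/- Let $G$ be a locally compact (Hausdorff) abelian group with a fixed Haar measure $dx$, dual group $\hat G$ (compact-open topology), and let $A$ be a commutative semisimple unital complex Banach algebra. For a commutative Banach algebra $B$ let $\Delta(B)$ be its character space with the Gelfand (weak-$*$) topology. A bounded continuous function $\sigma:\Delta(B)\to\mathbb C$ is a BSE function, $\sigma\in C_{BSE}(\Delta(B))$, if there is $\beta>0$ such that $$\Big|\sum_{i=1}^n c_i\sigma(\varphi_i)\Big|\le\beta\Big\|\sum_{i=1}^n c_i\varphi_i\Big\|_{B^*}$$ for all finite families $c_i\in\mathbb C$, $\varphi_i\in\Delta(B)$. It is a BED function, $\sigma\in C^0_{BSE}(\Delta(B))$, if moreover for every $\varepsilon>0$ there is a compact $K\subseteq\Delta(B)$ such that $$\Big|\sum_{i=1}^n c_i\sigma(\varphi_i)\Big|\le\varepsilon\Big\|\sum_{i=1}^n c_i\varphi_i\Big\|_{B^*}$$ for all finite families $c_i\in\mathbb C$, $\varphi_i\in\Delta(B)\setminus K$. Let $L^1(G,A)$ be the Banach algebra of Bochner integrable functions $G\to A$ under convolution. Its character space is identified with $\hat G\times\Delta(A)$: the map sending $(\chi,\varphi)$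 to the character $(\chi\otimes\varphi)(f)=\int_G\overline{\chi(x)}\,\varphi(f(x))\,dx$ is a homeomorphism of $\hat G\times\Delta(A)$ onto $\Delta(L^1(G,A))$. For $u:\hat G\to\mathbb C$ and $\sigma:\Delta(A)\to\mathbb C$ let $u\otimes\sigma$ be the function on $\Delta(L^1(G,A))$ with $(u\otimes\sigma)(\chi\otimes\varphi)=u(\chi)\sigma(\varphi)$. Then: (i) If $\mu\in M(G)$ (the regular complex Borel measures on $G$), $\hat\mu(\chi)=\int_G\overline{\chi(x)}\,d\mu(x)$ and $\sigma\in C_{BSE}(\Delta(A))$, then $\hat\mu\otimes\sigma\in C_{BSE}(\Delta(L^1(G,A)))$. (ii) If $f\in L^1(G)$, $\hat f(\chi)=\int_G\overline{\chi(x)}f(x)\,dx$ and $\sigma\in C^0_{BSE}(\Delta(A))$, then $\hat f\otimes\sigma\in C^0_{BSE}(\Delta(L^1(G,A)))$. -/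

import Mathlib

open MeasureTheory WeakDual
open scoped ENNReal

set_option linter.unusedSectionVars false

noncomputable section

namespace VectorGroupAlgebra

section Convolution

variable {G : Type*} [CommGroup G] [TopologicalSpace G] [IsTopologicalGroup G]
  [LocallyCompactSpace G] [MeasurableSpace G] [BorelSpace G]
  {m : Measure G} [m.IsHaarMeasure] [m.Regular]
  {A : Type*} [NormedCommRing A] [NormedAlgebra ℂ A]

/-- The translate `x ↦ g (t⁻¹ * x)` of `g ∈ L¹(G, A)`. -/
def translate (t : G) (g : Lp A 1 m) : Lp A 1 m :=
  Lp.compMeasurePreserving (fun x => t⁻¹ * x) (measurePreserving_mul_left m t⁻¹) g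

/-- The convolution `f ∗ g = ∫ f(t) g(t⁻¹ ·) dt` of `f, g ∈ L¹(G, A)`, as a Bochner integral with
values in the Banach space `L¹(G, A)`. -/
def conv (f g : Lp A 1 m) : Lp A 1 m := ∫ t, (f t) • translate t g ∂m

theorem translate_eq (t : G) (g : Lp A 1 m) :
    translate t g = DomMulAct.mk t⁻¹ • g := rfl

theorem norm_translate (t : G) (g : Lp A 1 m) : ‖translate t g‖ = ‖g‖ :=
  Lp.norm_compMeasurePreserving _ _

theorem translate_add (t : G) (g h : Lp A 1 m) :
    translate t (g + h) = translate t g + translate t h := map_add _ _ _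

theorem translate_smul (t : G) (c : A) (g : Lp A 1 m) :
    translate t (c • g) = c • translate t g := by
  rw [translate_eq, translate_eq, smul_comm]

theorem translate_mul (s t : G) (g : Lp A 1 m) :
    translate (s * t) g = translate s (translate t g) := by
  rw [translate_eq, translate_eq, translate_eq, smul_smul, ← DomMulAct.mk_mul]
  simp [mul_comm]

theorem translate_ae_eq (t : G) (g : Lp A 1 m) :
    translate t g =ᵐ[m] fun x => g (t⁻¹ * x) :=
  Lp.coeFn_compMeasurePreserving _ _

/-- Translation by `t` as a linear isometry of `L¹(G, A)`. -/
def translateCLM (t : G) : Lp A 1 m →L[ℂ] Lp A 1 m :=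
  (Lp.compMeasurePreservingₗᵢ ℂ (fun x => t⁻¹ * x)
    (measurePreserving_mul_left m t⁻¹)).toContinuousLinearMap

theorem translateCLM_apply (t : G) (g : Lp A 1 m) : translateCLM t g = translate t g := rfl

theorem continuous_translate (g : Lp A 1 m) : Continuous fun t : G => translate t g := by
  simp only [translate_eq]
  have : Fact ((1 : ℝ≥0∞) ≠ ∞) := ⟨ENNReal.one_ne_top⟩
  exact (DomMulAct.continuous_mk.comp continuous_inv).smul continuous_const

/-- Pointwise multiplication by `a` on `L¹(G, A)`. -/
def smulCLM (a : A) : Lp A 1 m →L[ℂ] Lp A 1 m :=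
  LinearMap.mkContinuous
    { toFun := fun g => a • g
      map_add' := fun g h => smul_add a g h
      map_smul' := fun c g => smul_comm a c g } ‖a‖ fun g => norm_smul_le a g

theorem smulCLM_apply (a : A) (g : Lp A 1 m) : smulCLM a g = a • g := rfl

theorem aestronglyMeasurable_restrict {V : Type*} [NormedAddCommGroup V] {F : G → V}
    (hF : Continuous F) {S : Set G} (hS : MeasurableSet S) (hm : m S ≠ ∞) :
    AEStronglyMeasurable F (m.restrict S) := by
  choose K hK using fun n : ℕ => hS.exists_isCompact_isClosed_sdiff_lt hm
    (ε := ((n : ℝ≥0∞) + 1)⁻¹) (by simp)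
  have h1 : AEStronglyMeasurable F (m.restrict (⋃ n, K n)) :=
    aestronglyMeasurable_iUnion_iff.2 fun n =>
      hF.continuousOn.aestronglyMeasurable_of_isCompact (hK n).2.1 (hK n).2.2.1.measurableSet
  have h0 : m (S \ ⋃ n, K n) = 0 := by
    have hlim : Filter.Tendsto (fun n : ℕ => ((n : ℝ≥0∞) + 1)⁻¹) Filter.atTop (nhds 0) := by
      simpa using (Filter.tendsto_add_atTop_iff_nat 1).2 ENNReal.tendsto_inv_nat_nhds_zero
    refine le_antisymm (ge_of_tendsto' hlim fun n => ?_) (zero_le)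
    exact (measure_mono (Set.sdiff_subset_sdiff_right (Set.subset_iUnion K n))).trans
      (hK n).2.2.2.le
  have h2 : (⋃ n, K n : Set G) =ᵐ[m] S :=
    Filter.EventuallyLE.antisymm
      (Set.iUnion_subset fun n => (hK n).1).eventuallyLE (ae_le_set.2 h0)
  rwa [Measure.restrict_congr_set h2] at h1

theorem aestronglyMeasurable_smul (f : Lp A 1 m) {F : G → Lp A 1 m} (hF : Continuous F) :
    AEStronglyMeasurable (fun t => (f t) • F t) m := by
  have hf : StronglyMeasurable f := Lp.stronglyMeasurable f
  have hi : Integrable f m := L1.integrable_coeFn f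
  let S : ℕ → Set G := fun n => {t | 1 / ((n : ℝ) + 1) ≤ ‖f t‖}
  have hS : ∀ n, MeasurableSet (S n) := fun n =>
    measurableSet_le measurable_const hf.norm.measurable
  have hfin : ∀ n, m (S n) ≠ ∞ := fun n =>
    (hi.measure_norm_ge_lt_top (by positivity)).ne
  have h1 : AEStronglyMeasurable (fun t => (f t) • F t) (m.restrict (⋃ n, S n)) :=
    aestronglyMeasurable_iUnion_iff.2 fun n =>
      hf.aestronglyMeasurable.smul (aestronglyMeasurable_restrict hF (hS n) (hfin n))
  have h2 := (aestronglyMeasurable_indicator_iff (MeasurableSet.iUnion hS)).2 h1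
  convert h2 using 1
  symm
  rw [Set.indicator_eq_self]
  intro t ht
  have hne : f t ≠ 0 := fun h => ht (by simp [h])
  obtain ⟨n, hn⟩ := exists_nat_one_div_lt (norm_pos_iff.2 hne)
  exact Set.mem_iUnion.2 ⟨n, hn.le⟩

theorem integrable_smul (f : Lp A 1 m) {F : G → Lp A 1 m} (hF : Continuous F) {C : ℝ}
    (hC : ∀ t, ‖F t‖ ≤ C) : Integrable (fun t => (f t) • F t) m := by
  refine ((L1.integrable_coeFn f).norm.mul_const C).mono' (aestronglyMeasurable_smul f hF) ?_
  refine Filter.Eventually.of_forall fun t => (norm_smul_le _ _).trans ?_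
  exact mul_le_mul_of_nonneg_left (hC t) (norm_nonneg _)

theorem integrable_conv (f g : Lp A 1 m) : Integrable (fun t => (f t) • translate t g) m :=
  integrable_smul f (continuous_translate g) fun t => (norm_translate t g).le

theorem conv_add (f g h : Lp A 1 m) : conv f (g + h) = conv f g + conv f h := by
  unfold conv
  rw [← integral_add (integrable_conv f g) (integrable_conv f h)]
  simp only [translate_add, smul_add]

theorem add_conv (f g h : Lp A 1 m) : conv (f + g) h = conv f h + conv g h := by
  unfold conv
  rw [← integral_add (integrable_conv f h) (integrable_conv g h)]
  refine integral_congr_ae ?_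
  filter_upwards [Lp.coeFn_add f g] with t ht
  rw [ht, Pi.add_apply, add_smul]

theorem zero_conv (f : Lp A 1 m) : conv 0 f = 0 := by simpa using add_conv 0 0 f

theorem conv_zero (f : Lp A 1 m) : conv f 0 = 0 := by simpa using conv_add f 0 0

theorem norm_conv_le (f g : Lp A 1 m) : ‖conv f g‖ ≤ ‖f‖ * ‖g‖ := by
  unfold conv
  rw [L1.norm_eq_integral_norm f, ← integral_mul_const]
  refine norm_integral_le_of_norm_le ((L1.integrable_coeFn f).norm.mul_const _) ?_
  refine Filter.Eventually.of_forall fun t => (norm_smul_le _ _).trans ?_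
  rw [norm_translate]

theorem smul_conv (c : ℂ) (f g : Lp A 1 m) : conv (c • f) g = c • conv f g := by
  unfold conv
  rw [← integral_smul]
  refine integral_congr_ae ?_
  filter_upwards [Lp.coeFn_smul c f] with t ht
  rw [ht, Pi.smul_apply, smul_assoc]

theorem conv_smul (c : ℂ) (f g : Lp A 1 m) : conv f (c • g) = c • conv f g := by
  unfold conv
  rw [← integral_smul]
  refine integral_congr_ae (Filter.Eventually.of_forall fun t => ?_)
  change f t • translateCLM t (c • g) = c • f t • translateCLM t g
  rw [map_smul, smul_comm]

theorem conv_assoc [CompleteSpace A] (f g h : Lp A 1 m) :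
    conv (conv f g) h = conv f (conv g h) := by
  let L : Lp A 1 m →L[ℂ] Lp A 1 m := LinearMap.mkContinuous
    { toFun := fun u => conv u h
      map_add' := fun u v => add_conv u v h
      map_smul' := fun c u => smul_conv c u h } ‖h‖
    fun u => by rw [mul_comm]; exact norm_conv_le u h
  have hL : ∀ u, L u = conv u h := fun _ => rfl
  rw [← hL]
  conv_lhs => rw [conv, ← ContinuousLinearMap.integral_comp_comm L (integrable_conv f g)]
  conv_rhs => rw [conv]
  refine integral_congr_ae (Filter.Eventually.of_forall fun s => ?_)
  change conv (f s • translate s g) h = f s • translate s (conv g h)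
  have e1 : conv (f s • translate s g) h
      = ∫ t, smulCLM (f s) (g (s⁻¹ * t) • translate t h) ∂m := by
    unfold conv
    refine integral_congr_ae ?_
    filter_upwards [Lp.coeFn_smul (f s) (translate s g), translate_ae_eq s g] with t h1 h2
    rw [h1, Pi.smul_apply, h2, smulCLM_apply, smul_assoc]
  have e2 := integral_mul_left_eq_self (μ := m)
    (fun t => smulCLM (f s) (g (s⁻¹ * t) • translate t h)) s
  rw [e1, ← e2]
  have e3 : ∀ t, smulCLM (f s) (g (s⁻¹ * (s * t)) • translate (s * t) h)
      = ((smulCLM (f s)).comp (translateCLM s)) (g t • translate t h) := by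
    intro t
    rw [inv_mul_cancel_left, translate_mul, ContinuousLinearMap.comp_apply, translateCLM_apply,
      translate_smul]
  simp only [e3]
  rw [ContinuousLinearMap.integral_comp_comm _ (integrable_conv g h)]
  rfl

end Convolution

section Algebra

variable {G : Type*} [CommGroup G] [TopologicalSpace G] [IsTopologicalGroup G]
  [LocallyCompactSpace G] [MeasurableSpace G] [BorelSpace G]

/-- The vector-valued group algebra `L¹(G, A)`: (classes of) Bochner integrable functions `G → A`
with respect to a Haar measure `m`, the `L¹`-norm, and convolution as multiplication. -/
def L1 (m : Measure G) (A : Type*) [NormedCommRing A] : Type _ := Lp A 1 m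

variable {m : Measure G} [m.IsHaarMeasure] [m.Regular]
  {A : Type*} [NormedCommRing A] [NormedAlgebra ℂ A] [CompleteSpace A]

/-- The representative of a class in `L¹(G, A)` as a function `G → A`. -/
def L1.rep : L1 m A → G → A := fun (f : Lp A 1 m) => f

instance : CoeFun (L1 m A) (fun _ => G → A) := ⟨L1.rep⟩

instance : NonUnitalNormedRing (L1 m A) :=
  { (inferInstance : NormedAddCommGroup (Lp A 1 m)) with
    mul := conv
    left_distrib := conv_add
    right_distrib := add_conv
    zero_mul := zero_conv
    mul_zero := conv_zero
    mul_assoc := conv_assoc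
    norm_mul_le := norm_conv_le }

instance : NormedSpace ℂ (L1 m A) :=
  { (inferInstance : Module ℂ (Lp A 1 m)) with
    norm_smul_le := fun c (f : Lp A 1 m) => norm_smul_le c f }

instance : IsScalarTower ℂ (L1 m A) (L1 m A) := ⟨smul_conv⟩

instance : SMulCommClass ℂ (L1 m A) (L1 m A) := ⟨fun c f g => (conv_smul c f g).symm⟩

theorem mul_def (f g : L1 m A) : f * g = conv (A := A) (m := m) f g := rfl

end Algebra

section BSE

variable {B : Type*} [NonUnitalNormedRing B] [NormedSpace ℂ B]

/-- `σ ∈ C_BSE(Δ(B))`: a bounded continuous function `σ` on the character space such that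
`|∑ cᵢ σ(φᵢ)| ≤ β ‖∑ cᵢ φᵢ‖` (norm of the dual space of `B`) for some constant `β > 0`. -/
def IsBSE (σ : characterSpace ℂ B → ℂ) : Prop :=
  Continuous σ ∧ (∃ C : ℝ, ∀ φ, ‖σ φ‖ ≤ C) ∧
    ∃ β : ℝ, 0 < β ∧ ∀ (n : ℕ) (c : Fin n → ℂ) (φ : Fin n → characterSpace ℂ B),
      ‖∑ i, c i * σ (φ i)‖ ≤ β * ‖∑ i, c i • CharacterSpace.toCLM (φ i)‖

/-- `σ ∈ C⁰_BSE(Δ(B))`: a BSE function for which the inequality holds with any prescribed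
`ε > 0` for characters outside a suitable compact set. -/
def IsBED (σ : characterSpace ℂ B → ℂ) : Prop :=
  IsBSE σ ∧ ∀ ε : ℝ, 0 < ε → ∃ K : Set (characterSpace ℂ B), IsCompact K ∧
    ∀ (n : ℕ) (c : Fin n → ℂ) (φ : Fin n → characterSpace ℂ B), (∀ i, φ i ∉ K) →
      ‖∑ i, c i * σ (φ i)‖ ≤ ε * ‖∑ i, c i • CharacterSpace.toCLM (φ i)‖

end BSE

section Fourier

variable {G : Type*} [CommGroup G] [TopologicalSpace G] [IsTopologicalGroup G]
  [MeasurableSpace G] [BorelSpace G]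

/-- Regularity of a complex Borel measure; `M(G)` consists of the regular complex measures. -/
def IsRegularMeasure (μ : ComplexMeasure G) : Prop :=
  ∀ E : Set G, MeasurableSet E → ∀ ε : ℝ, 0 < ε → ∃ K U : Set G,
    IsCompact K ∧ IsOpen U ∧ K ⊆ E ∧ E ⊆ U ∧
      ∀ F : Set G, MeasurableSet F → F ⊆ U \ K → ‖μ F‖ < ε

/-- The Fourier–Stieltjes transform `μ̂(χ) = ∫ conj χ(x) dμ(x)`. -/
def fourierStieltjes (μ : ComplexMeasure G) (χ : PontryaginDual G) : ℂ :=
  VectorMeasure.integral μ (fun x => starRingEnd ℂ (χ x : ℂ)) (ContinuousLinearMap.mul ℝ ℂ)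

/-- The Fourier transform `f̂(χ) = ∫ conj χ(x) f(x) dx` of `f ∈ L¹(G)`. -/
def fourier (m : Measure G) (f : L1 m ℂ) (χ : PontryaginDual G) : ℂ :=
  ∫ x, starRingEnd ℂ (χ x : ℂ) * f x ∂m

end Fourier

end VectorGroupAlgebra

end

noncomputable section

namespace VectorGroupAlgebra

/-! ### Total variation of a complex measure -/

section ComplexMeasure

variable {X : Type*} [MeasurableSpace X]

/-! Both parts rest on one inequality. Write `N` for the dual norm of `∑ cᵢ (χᵢ ⊗ φᵢ)`. Testing this
functional on `a • 1_S / m(S)`, with `S` a small neighbourhood of `x`, gives `|∑ cᵢ conj χᵢ(x)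
φᵢ(a)| ≤ N ‖a‖` for all `x` and `a` (`norm_sum_apply_le_norm_sum_tensorCharacter`). Hence `∑ cᵢ conj
χᵢ(x) φᵢ` has norm at most `N` in the dual of `A`, and the BSE inequality for `σ` yields `|∑ cᵢ
σ(φᵢ) conj χᵢ(x)| ≤ β N` uniformly in `x` (`norm_sum_mul_le`). Integrating against `μ`, or against
`f dx`, gives the BSE inequality for the tensor product.

For the BED statement, `Δ(A)` is compact because `A` is unital, so only decay in `Ĝ` matters. If `ĝ`
vanishes off a compact `K` and `‖f - g‖ ≤ ε / β`, then off `K × Δ(A)` the function `f̂ ⊗ σ` equals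
`(f - g)^ ⊗ σ`, whose BSE constant is at most `ε`. It remains to see that such `g` are dense
(`exists_fourierCLM_compactSupport`).

The density is proved without Plancherel or Fourier inversion. Factor `f = conj v · u` with `u, v ∈
L²`, and let `T` be a continuous spectral cutoff of convolution by some `f₀ ∈ L¹(G)`, chosen so that
`T v`, `T u` are close to `v`, `u`. For `g = conj (T v) · T u` one gets `ĝ(χ) = ⟪v, T* T_χ (conj χ ·
u)⟫`, where `T_χ` is the same cutoff of convolution by `conj χ · f₀`. Gelfand theory in the
commutative von Neumann algebra of translations, with Riemann–Lebesgue, gives `T* T_χ = 0` for `χ`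
off a compact set (`exists_isCompact_star_cfc_mul_cfc_eq_zero`).

The identification of the character space comes from the two symmetries of `L¹(G, A)`: convolution
commutes with translations and with multiplication by `A`, so a character transforms under the
former by some `conj χ` and under the latter by some `φ`. -/

theorem signedMeasure_variation_le (ν : SignedMeasure X) {S : Set X} (hS : MeasurableSet S)
    {C : ℝ≥0∞} (h : ∀ F, MeasurableSet F → F ⊆ S → ‖ν F‖ₑ ≤ C) : ν.variation S ≤ 2 * C := by
  by_contra! hlt
  obtain ⟨t, hts, ht, hlt'⟩ := ν.exists_subset_lt_enorm_apply_of_lt_variation hS hlt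
  exact absurd hlt' (not_lt.2 (mul_le_mul_right (h t ht hts) 2))

/-- Real and imaginary parts each contribute a factor 2, from the signed case. Through this lemma,
bounds on the values of `μ` become bounds on its variation, giving finiteness and tightness. -/
theorem complexMeasure_variation_le (μ : ComplexMeasure X) {S : Set X} (hS : MeasurableSet S)
    {C : ℝ≥0∞} (h : ∀ F, MeasurableSet F → F ⊆ S → ‖μ F‖ₑ ≤ C) : μ.variation S ≤ 4 * C := by
  have hre : ∀ F, (ComplexMeasure.re μ) F = (μ F).re := fun F => rfl
  have him : ∀ F, (ComplexMeasure.im μ) F = (μ F).im := fun F => rfl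
  have h1 : (ComplexMeasure.re μ).variation S ≤ 2 * C :=
    signedMeasure_variation_le _ hS fun F hF hFS => by
      refine le_trans ?_ (h F hF hFS)
      rw [hre]
      exact enorm_le_iff_norm_le.2 (Complex.abs_re_le_norm _)
  have h2 : (ComplexMeasure.im μ).variation S ≤ 2 * C :=
    signedMeasure_variation_le _ hS fun F hF hFS => by
      refine le_trans ?_ (h F hF hFS)
      rw [him]
      exact enorm_le_iff_norm_le.2 (Complex.abs_im_le_norm _)
  have h3 : μ.variation ≤ (ComplexMeasure.re μ).variation + (ComplexMeasure.im μ).variation := by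
    refine VectorMeasure.variation_le_of_forall_enorm_le fun E _ => ?_
    have h4 : ‖μ E‖ₑ ≤ ‖(ComplexMeasure.re μ) E‖ₑ + ‖(ComplexMeasure.im μ) E‖ₑ := by
      rw [hre, him]
      calc ‖μ E‖ₑ = ‖((μ E).re : ℂ) + (μ E).im * Complex.I‖ₑ := by rw [Complex.re_add_im]
        _ ≤ ‖((μ E).re : ℂ)‖ₑ + ‖((μ E).im : ℂ) * Complex.I‖ₑ := enorm_add_le _ _
        _ = _ := by
          rw [enorm_mul, ← ofReal_norm, ← ofReal_norm, ← ofReal_norm, ← ofReal_norm, ← ofReal_norm]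
          simp
    exact h4.trans (add_le_add (VectorMeasure.enorm_measure_le_variation _ _)
      (VectorMeasure.enorm_measure_le_variation _ _))
  calc μ.variation S ≤ 2 * C + 2 * C := (h3 S).trans (by simpa using add_le_add h1 h2)
    _ = 4 * C := by ring

instance isFiniteMeasure_variation (μ : ComplexMeasure X) : IsFiniteMeasure μ.variation := by
  refine ⟨lt_of_le_of_lt (complexMeasure_variation_le μ MeasurableSet.univ (C := μ.bound)
    fun F _ _ => VectorMeasure.enorm_apply_le_bound) ?_⟩
  exact ENNReal.mul_lt_top (by simp) (by simp)

end ComplexMeasure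

/-! ### Characters of `G` and the compact-open topology -/

section Characters

variable {G : Type*} [CommGroup G] [TopologicalSpace G] [IsTopologicalGroup G]

theorem continuous_coe_character (χ : PontryaginDual G) : Continuous fun x : G => (χ x : ℂ) :=
  continuous_subtype_val.comp (map_continuous χ)

theorem continuous_conj_character (χ : PontryaginDual G) :
    Continuous fun x : G => starRingEnd ℂ (χ x : ℂ) :=
  Complex.continuous_conj.comp (continuous_coe_character χ)

theorem norm_conj_character (χ : PontryaginDual G) (x : G) : ‖starRingEnd ℂ (χ x : ℂ)‖ = 1 :=
  (Complex.norm_conj _).trans (Circle.norm_coe _)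

theorem eventually_character_close (χ₀ : PontryaginDual G) {K : Set G} (hK : IsCompact K) {ε : ℝ}
    (hε : 0 < ε) : ∀ᶠ χ in nhds χ₀, ∀ x ∈ K,
      ‖starRingEnd ℂ (χ x : ℂ) - starRingEnd ℂ (χ₀ x : ℂ)‖ < ε := by
  have hc : Continuous fun χ : PontryaginDual G =>
      (ContinuousMonoidHom.toContinuousMap (A := G) (B := Circle) χ) :=
    (ContinuousMonoidHom.isInducing_toContinuousMap G Circle).continuous
  have h := (ContinuousMap.tendsto_iff_forall_isCompact_tendstoUniformlyOn.1 (hc.tendsto χ₀)) K hK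
  filter_upwards [Metric.tendstoUniformlyOn_iff.1 h ε hε] with χ hχ x hx
  have : dist (χ₀ x : ℂ) (χ x : ℂ) < ε := hχ x hx
  rw [dist_eq_norm] at this
  rw [← map_sub, Complex.norm_conj, norm_sub_rev]
  exact this

theorem integrable_conj_character [MeasurableSpace G] [BorelSpace G] (ν : Measure G)
    [IsFiniteMeasure ν] (χ : PontryaginDual G) :
    Integrable (fun x => starRingEnd ℂ (χ x : ℂ)) ν :=
  Integrable.of_bound (continuous_conj_character χ).measurable.aestronglyMeasurable 1
    (Filter.Eventually.of_forall fun x => (norm_conj_character χ x).le)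

/-- On a large compact set the characters converge uniformly; off it the integrand is at most 2 and
the mass is small. The splitting replaces dominated convergence, since neighbourhood filters of the
dual group need not be countably generated. -/
theorem tendsto_integral_character_sub [T2Space G] [MeasurableSpace G] [BorelSpace G]
    (ν : Measure G) [IsFiniteMeasure ν]
    (hν : ∀ ε : ℝ, 0 < ε → ∃ K : Set G, IsCompact K ∧ ν.real Kᶜ ≤ ε) (χ₀ : PontryaginDual G) :
    Filter.Tendsto (fun χ : PontryaginDual G =>
      ∫ x, ‖starRingEnd ℂ (χ x : ℂ) - starRingEnd ℂ (χ₀ x : ℂ)‖ ∂ν) (nhds χ₀) (nhds 0) := by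
  rw [Metric.tendsto_nhds]
  intro ε hε
  -- The complement contributes at most `2 · ε / 8` and the compact set at most `ε / 2`.
  obtain ⟨K, hK, hKν⟩ := hν (ε / 8) (by positivity)
  have hM : 0 < ν.real Set.univ + 1 := by positivity
  filter_upwards [eventually_character_close χ₀ hK (ε := ε / (2 * (ν.real Set.univ + 1)))
    (by positivity)] with χ hχ
  have hle : ∀ x, ‖starRingEnd ℂ (χ x : ℂ) - starRingEnd ℂ (χ₀ x : ℂ)‖ ≤
      ε / (2 * (ν.real Set.univ + 1)) + Kᶜ.indicator (fun _ => (2 : ℝ)) x := by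
    intro x
    by_cases hx : x ∈ K
    · simpa [hx] using (hχ x hx).le
    · have h2 := norm_sub_le (starRingEnd ℂ (χ x : ℂ)) (starRingEnd ℂ (χ₀ x : ℂ))
      rw [norm_conj_character, norm_conj_character] at h2
      have h3 : 0 < ε / (2 * (ν.real Set.univ + 1)) := by positivity
      simp only [Set.mem_compl_iff, hx, not_false_eq_true, Set.indicator_of_mem]
      linarith
  have hKm : MeasurableSet Kᶜ := hK.isClosed.measurableSet.compl
  have hi : Integrable (Kᶜ.indicator fun _ : G => (2 : ℝ)) ν :=
    (integrable_const _).indicator hKm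
  have h1 := integral_mono
    ((integrable_conj_character ν χ).sub (integrable_conj_character ν χ₀)).norm
    ((integrable_const (ε / (2 * (ν.real Set.univ + 1)))).add hi) hle
  rw [integral_add' (integrable_const _) hi, integral_indicator hKm] at h1
  simp only [integral_const, smul_eq_mul, measureReal_restrict_apply_univ, Pi.sub_apply] at h1
  have h2 : ν.real Set.univ * (ε / (2 * (ν.real Set.univ + 1))) ≤ ε / 2 := by
    rw [mul_div_assoc', div_le_div_iff₀ (by positivity) (by positivity)]
    nlinarith
  rw [Real.dist_eq, sub_zero, abs_of_nonneg (integral_nonneg fun _ => norm_nonneg _)]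
  linarith

end Characters

/-! ### Fourier–Stieltjes transforms of regular measures -/

section FourierStieltjes

variable {G : Type*} [CommGroup G] [TopologicalSpace G] [IsTopologicalGroup G]
  [MeasurableSpace G] [BorelSpace G]

/-- Regularity at `E = G` forces `U = G`, so `μ` is small on every measurable subset of `Kᶜ`; the `ε
/ 4` absorbs the factor 4 lost in passing to the variation. -/
theorem IsRegularMeasure.tight [T2Space G] {μ : ComplexMeasure G} (hμ : IsRegularMeasure μ) {ε : ℝ}
    (hε : 0 < ε) : ∃ K : Set G, IsCompact K ∧ μ.variation.real Kᶜ ≤ ε := by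
  obtain ⟨K, U, hK, -, -, hU, h⟩ := hμ Set.univ MeasurableSet.univ (ε / 4) (by positivity)
  refine ⟨K, hK, ?_⟩
  have h1 : μ.variation Kᶜ ≤ 4 * ENNReal.ofReal (ε / 4) :=
    complexMeasure_variation_le μ hK.isClosed.measurableSet.compl fun F hF hFK => by
      rw [← ofReal_norm]
      exact ENNReal.ofReal_le_ofReal (h F hF fun x hx => ⟨hU (Set.mem_univ x), hFK hx⟩).le
  have h2 := ENNReal.toReal_mono (ENNReal.mul_ne_top (by simp) (by simp)) h1
  rw [ENNReal.toReal_mul, ENNReal.toReal_ofReal (by positivity)] at h2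
  simp only [ENNReal.toReal_ofNat] at h2
  rw [measureReal_def]
  linarith

theorem norm_integral_complexMeasure_le (μ : ComplexMeasure G) (p : G → ℂ) :
    ‖VectorMeasure.integral μ p (ContinuousLinearMap.mul ℝ ℂ)‖ ≤ ∫ x, ‖p x‖ ∂μ.variation := by
  refine VectorMeasure.norm_integral_le_integral_norm.trans ?_
  exact mul_le_of_le_one_left (integral_nonneg fun _ => norm_nonneg _)
    (ContinuousLinearMap.opNorm_mul_le ℝ ℂ)

theorem continuous_fourierStieltjes [T2Space G] {μ : ComplexMeasure G} (hμ : IsRegularMeasure μ) :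
    Continuous (fourierStieltjes μ) := by
  rw [continuous_iff_continuousAt]
  intro χ₀
  refine tendsto_iff_norm_sub_tendsto_zero.2 (squeeze_zero (fun _ => norm_nonneg _) (fun χ => ?_)
    (tendsto_integral_character_sub μ.variation (fun ε hε => hμ.tight hε) χ₀))
  unfold fourierStieltjes
  rw [← VectorMeasure.integral_fun_sub (integrable_conj_character _ χ)
    (integrable_conj_character _ χ₀)]
  exact norm_integral_complexMeasure_le μ _

/-- The integral is built from an `ℝ`-bilinear pairing, so complex homogeneity has to be recovered
from associativity of multiplication. -/
theorem integral_complexMeasure_const_mul (μ : ComplexMeasure G) {p : G → ℂ}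
    (c : ℂ) : VectorMeasure.integral μ (fun x => c * p x) (ContinuousLinearMap.mul ℝ ℂ) =
      c * VectorMeasure.integral μ p (ContinuousLinearMap.mul ℝ ℂ) := by
  have h := setToFun_smul (𝕜 := ℂ) (dominatedFinMeasAdditive_cbmApplyMeasure μ
    (ContinuousLinearMap.mul ℝ ℂ)) (fun c s x => mul_assoc c x (μ s)) c p
  exact h

theorem norm_sum_fourierStieltjes_le (μ : ComplexMeasure G) {n : ℕ} (c : Fin n → ℂ)
    (χ : Fin n → PontryaginDual G) {C : ℝ}
    (h : ∀ x, ‖∑ i, c i * starRingEnd ℂ (χ i x : ℂ)‖ ≤ C) :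
    ‖∑ i, c i * fourierStieltjes μ (χ i)‖ ≤ μ.variation.real Set.univ * C := by
  have e : ∑ i, c i * fourierStieltjes μ (χ i) = VectorMeasure.integral μ
      (fun x => ∑ i, c i * starRingEnd ℂ (χ i x : ℂ)) (ContinuousLinearMap.mul ℝ ℂ) := by
    rw [VectorMeasure.integral_finsetSum]
    · simp only [integral_complexMeasure_const_mul]
      rfl
    · exact fun i _ => (integrable_conj_character _ (χ i)).const_mul _
  rw [e]
  refine (norm_integral_complexMeasure_le μ _).trans ?_
  calc _ ≤ ∫ _, C ∂μ.variation := integral_mono_of_nonneg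
        (Filter.Eventually.of_forall fun _ => norm_nonneg _) (integrable_const C)
        (Filter.Eventually.of_forall h)
    _ = _ := by simp

end FourierStieltjes

/-! ### The `A`-valued Fourier transform -/

section FourierTransform

variable {G : Type*} [CommGroup G] [TopologicalSpace G] [IsTopologicalGroup G]
  [LocallyCompactSpace G] [MeasurableSpace G] [BorelSpace G]
  {m : Measure G} [m.IsHaarMeasure] [m.Regular]
  {A : Type*} [NormedCommRing A] [NormedAlgebra ℂ A]

theorem integrable_character_smul (χ : PontryaginDual G) {f : G → A} (hf : Integrable f m) :
    Integrable (fun x => starRingEnd ℂ (χ x : ℂ) • f x) m :=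
  hf.bdd_smul 1 (continuous_conj_character χ).measurable.aestronglyMeasurable
    (Filter.Eventually.of_forall fun x => (norm_conj_character χ x).le)

/-- The vector-valued Fourier transform `f ↦ ∫ conj χ(x) f(x) dx` at the character `χ`. -/
def fourierCLM (m : Measure G) [m.IsHaarMeasure] [m.Regular] (A : Type*) [NormedCommRing A]
    [NormedAlgebra ℂ A] (χ : PontryaginDual G) : Lp A 1 m →L[ℂ] A :=
  LinearMap.mkContinuous
    { toFun := fun f => ∫ x, starRingEnd ℂ (χ x : ℂ) • f x ∂m
      map_add' := fun f g => by
        rw [← integral_add (integrable_character_smul χ (L1.integrable_coeFn f))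
          (integrable_character_smul χ (L1.integrable_coeFn g))]
        refine integral_congr_ae ?_
        filter_upwards [Lp.coeFn_add f g] with t ht
        rw [ht, Pi.add_apply, smul_add]
      map_smul' := fun c f => by
        rw [RingHom.id_apply, ← integral_smul]
        refine integral_congr_ae ?_
        filter_upwards [Lp.coeFn_smul c f] with t ht
        rw [ht, Pi.smul_apply, smul_comm] } 1 fun f => by
    rw [one_mul, L1.norm_eq_integral_norm f]
    refine norm_integral_le_of_norm_le (L1.integrable_coeFn f).norm
      (Filter.Eventually.of_forall fun x => ?_)
    rw [norm_smul, norm_conj_character, one_mul]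

theorem fourierCLM_apply (χ : PontryaginDual G) (f : Lp A 1 m) :
    fourierCLM m A χ f = ∫ x, starRingEnd ℂ (χ x : ℂ) • f x ∂m := rfl

theorem norm_fourierCLM_le (χ : PontryaginDual G) (f : Lp A 1 m) : ‖fourierCLM m A χ f‖ ≤ ‖f‖ := by
  simpa using (LinearMap.mkContinuous_norm_le _ zero_le_one _ : ‖fourierCLM m A χ‖ ≤ 1)
    |> fun h => (fourierCLM m A χ).le_of_opNorm_le h f

theorem fourierCLM_translate (χ : PontryaginDual G) (t : G) (g : Lp A 1 m) :
    fourierCLM m A χ (translate t g) = starRingEnd ℂ (χ t : ℂ) • fourierCLM m A χ g := by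
  rw [fourierCLM_apply, fourierCLM_apply, ← integral_smul]
  rw [← integral_mul_left_eq_self (μ := m)
    (fun x => starRingEnd ℂ (χ t : ℂ) • (starRingEnd ℂ (χ x : ℂ) • g x)) t⁻¹]
  refine integral_congr_ae ?_
  filter_upwards [translate_ae_eq t g] with x hx
  rw [hx, smul_smul, ← map_mul, ← Circle.coe_mul, ← map_mul, mul_inv_cancel_left]

theorem fourierCLM_smul [CompleteSpace A] (χ : PontryaginDual G) (a : A) (g : Lp A 1 m) :
    fourierCLM m A χ (a • g) = a * fourierCLM m A χ g := by
  refine Eq.trans (integral_congr_ae ?_) ((ContinuousLinearMap.mul ℂ A a).integral_comp_comm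
    (integrable_character_smul χ (L1.integrable_coeFn g)))
  filter_upwards [Lp.coeFn_smul a g] with x hx
  rw [hx, Pi.smul_apply, smul_comm, smul_eq_mul, ContinuousLinearMap.mul_apply']

theorem fourierCLM_conv [CompleteSpace A] (χ : PontryaginDual G) (f g : Lp A 1 m) :
    fourierCLM m A χ (conv f g) = fourierCLM m A χ f * fourierCLM m A χ g := by
  rw [conv, ← ContinuousLinearMap.integral_comp_comm _ (integrable_conv f g)]
  refine Eq.trans (integral_congr_ae (Filter.Eventually.of_forall fun t => ?_))
    (((ContinuousLinearMap.mul ℂ A).flip (fourierCLM m A χ g)).integral_comp_comm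
      (integrable_character_smul χ (L1.integrable_coeFn f)))
  change fourierCLM m A χ (f t • translate t g) =
    (starRingEnd ℂ (χ t : ℂ) • f t) * fourierCLM m A χ g
  rw [fourierCLM_smul, fourierCLM_translate, smul_mul_assoc, mul_smul_comm]

/-- Normalised indicators of such sets act as approximate point masses. The lemma serves to recover
point values of trigonometric polynomials, to find a function on which a character is nonzero, and
to build approximate units on `L²(G)`. -/
theorem exists_measurableSet_near {E : Type*} [PseudoMetricSpace E] (m : Measure G)
    [m.IsHaarMeasure] {p : G → E} (hp : Continuous p)
    (x : G) {ε : ℝ} (hε : 0 < ε) : ∃ S : Set G, MeasurableSet S ∧ m S ≠ ∞ ∧ 0 < m.real S ∧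
      ∀ y ∈ S, dist (p y) (p x) < ε := by
  obtain ⟨K, hK, hxK⟩ := exists_compact_mem_nhds x
  let U : Set G := interior K ∩ p ⁻¹' Metric.ball (p x) ε
  have hU : IsOpen U := isOpen_interior.inter (Metric.isOpen_ball.preimage hp)
  have hxU : x ∈ U := ⟨mem_interior_iff_mem_nhds.2 hxK, Metric.mem_ball_self hε⟩
  have hfin : m U ≠ ∞ := (measure_mono (Set.inter_subset_left.trans interior_subset)).trans_lt
    hK.measure_lt_top |>.ne
  exact ⟨U, hU.measurableSet, hfin,
    ENNReal.toReal_pos (hU.measure_pos m ⟨x, hxU⟩).ne' hfin, fun y hy => hy.2⟩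

theorem fourierCLM_indicatorConstLp [CompleteSpace A] (χ : PontryaginDual G) {S : Set G}
    (hS : MeasurableSet S) (hm : m S ≠ ∞) (a : A) :
    fourierCLM m A χ (indicatorConstLp 1 hS hm a) =
      (∫ x in S, starRingEnd ℂ (χ x : ℂ) ∂m) • a := by
  rw [fourierCLM_apply, ← integral_smul_const, ← integral_indicator hS]
  refine integral_congr_ae ?_
  filter_upwards [indicatorConstLp_coeFn (p := 1) (hs := hS) (hμs := hm) (c := a)] with x hx
  rw [hx]
  by_cases h : x ∈ S <;> simp [h]

/-- For an indicator the restricted measure is finite and tight. The general case follows because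
simple functions are dense and `L¹` convergence makes the transforms converge uniformly. -/
theorem continuous_fourierCLM [T2Space G] [CompleteSpace A] (f : Lp A 1 m) :
    Continuous fun χ : PontryaginDual G => fourierCLM m A χ f := by
  refine Lp.induction ENNReal.one_ne_top
    (motive := fun f => Continuous fun χ : PontryaginDual G => fourierCLM m A χ f)
    (fun a S hS hm => ?_) (fun f g hf hg _ h₁ h₂ => ?_) ?_ f
  · simp only [Lp.simpleFunc.coe_indicatorConst, fourierCLM_indicatorConstLp]
    refine Continuous.smul ?_ continuous_const
    have hfin : IsFiniteMeasure (m.restrict S) := ⟨by simpa using hm⟩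
    rw [continuous_iff_continuousAt]
    intro χ₀
    refine tendsto_iff_norm_sub_tendsto_zero.2 (squeeze_zero (fun _ => norm_nonneg _) (fun χ => ?_)
      (tendsto_integral_character_sub (m.restrict S) (fun ε hε => ?_) χ₀))
    · change ‖∫ x in S, _ ∂m - ∫ x in S, _ ∂m‖ ≤ _
      rw [← integral_sub (integrable_conj_character _ χ) (integrable_conj_character _ χ₀)]
      exact norm_integral_le_integral_norm _
    · obtain ⟨K, hKS, hK, hKc, hlt⟩ := hS.exists_isCompact_isClosed_sdiff_lt hm.ne
        (ENNReal.ofReal_pos.2 hε).ne'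
      refine ⟨K, hK, ENNReal.toReal_le_of_le_ofReal hε.le (le_trans (le_of_eq ?_) hlt.le)⟩
      rw [Measure.restrict_apply hKc.measurableSet.compl, Set.inter_comm]
      rfl
  · simp only [map_add]
    exact h₁.add h₂
  · refine isClosed_of_closure_subset fun f hf => ?_
    refine continuous_of_uniform_approx_of_continuous fun u hu => ?_
    obtain ⟨ε, hε, hu⟩ := Metric.mem_uniformity_dist.1 hu
    obtain ⟨g, hg, hfg⟩ := Metric.mem_closure_iff.1 hf ε hε
    refine ⟨_, hg, fun χ => hu ?_⟩
    rw [dist_eq_norm, ← map_sub]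
    exact (norm_fourierCLM_le χ _).trans_lt (by rwa [← dist_eq_norm])

end FourierTransform

/-! ### Averages over small sets -/

section Average

variable {X : Type*} [MeasurableSpace X] {m : Measure X} {E : Type*} [NormedAddCommGroup E]
  [NormedSpace ℝ E] [CompleteSpace E]

theorem norm_setIntegral_sub_le {S : Set X} (hm : m S ≠ ∞) {p : X → E}
    (hp : IntegrableOn p S m) (v : E) {ε : ℝ} (h : ∀ y ∈ S, dist (p y) v < ε) :
    ‖∫ y in S, p y ∂m - m.real S • v‖ ≤ ε * m.real S := by
  have e : ∫ y in S, p y ∂m - m.real S • v = ∫ y in S, (p y - v) ∂m := by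
    rw [integral_sub hp (integrableOn_const hm), setIntegral_const]
  rw [e]
  refine norm_setIntegral_le_of_norm_le_const (lt_top_iff_ne_top.2 hm) fun y hy => ?_
  rw [← dist_eq_norm]
  exact (h y hy).le

end Average

/-! ### The character space of `L¹(G, A)` -/

section Characters

variable {G : Type*} [CommGroup G] [TopologicalSpace G] [IsTopologicalGroup G]
  [LocallyCompactSpace G] [MeasurableSpace G] [BorelSpace G]
  {m : Measure G} [m.IsHaarMeasure] [m.Regular]
  {A : Type*} [NormedCommRing A] [NormedAlgebra ℂ A] [CompleteSpace A]

/-- The functional `f ↦ ∫ conj χ(x) φ(f(x)) dx` on `L¹(G, A)`. -/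
def tensorCLM (χ : PontryaginDual G) (φ : characterSpace ℂ A) : L1 m A →L[ℂ] ℂ :=
  (CharacterSpace.toCLM φ).comp (fourierCLM m A χ)

theorem tensorCLM_apply (χ : PontryaginDual G) (φ : characterSpace ℂ A) (f : Lp A 1 m) :
    tensorCLM (m := m) χ φ f = φ (fourierCLM m A χ f) := rfl

theorem exists_tensorCLM_ne_zero (m : Measure G) [m.IsHaarMeasure] [m.Regular]
    (χ : PontryaginDual G) (φ : characterSpace ℂ A) :
    ∃ f : L1 m A, tensorCLM χ φ f ≠ 0 := by
  obtain ⟨S, hS, hm, hpos, h⟩ := exists_measurableSet_near m (continuous_conj_character χ) 1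
    one_half_pos
  -- On `S` the values of `conj χ` lie within `1/2` of a number of modulus 1, so its integral over
  -- `S` cannot vanish.
  refine ⟨(indicatorConstLp 1 hS hm (1 : A) : Lp A 1 m), ?_⟩
  rw [tensorCLM_apply, fourierCLM_indicatorConstLp, map_smul, map_one, smul_eq_mul, mul_one]
  intro h0
  have hint : IntegrableOn (fun x => starRingEnd ℂ (χ x : ℂ)) S m := by
    have : IsFiniteMeasure (m.restrict S) := ⟨by simpa using lt_top_iff_ne_top.2 hm⟩
    exact integrable_conj_character _ χ
  have h1 := norm_setIntegral_sub_le hm hint _ h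
  rw [h0, zero_sub, norm_neg, norm_smul, norm_conj_character, Real.norm_of_nonneg hpos.le] at h1
  linarith

/-- The character `χ ⊗ φ` of `L¹(G, A)`. -/
def tensorCharacter (χ : PontryaginDual G) (φ : characterSpace ℂ A) :
    characterSpace ℂ (L1 m A) :=
  ⟨(tensorCLM χ φ : L1 m A →L[ℂ] ℂ), by
    obtain ⟨f, hf⟩ := exists_tensorCLM_ne_zero m χ φ
    refine ⟨fun h => hf ?_, fun f g => ?_⟩
    · exact DFunLike.congr_fun h f
    · exact (congrArg φ (fourierCLM_conv χ f g)).trans (map_mul φ _ _)⟩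

theorem tensorCharacter_apply (χ : PontryaginDual G) (φ : characterSpace ℂ A) (f : Lp A 1 m) :
    tensorCharacter (m := m) χ φ f = φ (fourierCLM m A χ f) := rfl

theorem tensorCharacter_apply_eq_integral (χ : PontryaginDual G) (φ : characterSpace ℂ A)
    (f : L1 m A) : tensorCharacter χ φ f = ∫ x, starRingEnd ℂ (χ x : ℂ) * φ (f x) ∂m := by
  have h := (CharacterSpace.toCLM φ).integral_comp_comm
    (integrable_character_smul χ (L1.integrable_coeFn (f : Lp A 1 m)))
  refine Eq.trans ?_ (h.symm.trans ?_)
  · rfl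
  · refine integral_congr_ae (Filter.Eventually.of_forall fun x => ?_)
    exact map_smul φ _ _

theorem tensorCharacter_smul (χ : PontryaginDual G) (φ : characterSpace ℂ A) (a : A)
    (f : Lp A 1 m) : tensorCharacter (m := m) χ φ (a • f : Lp A 1 m) =
      φ a * tensorCharacter (m := m) χ φ f := by
  rw [tensorCharacter_apply, tensorCharacter_apply, fourierCLM_smul, map_mul]

theorem tensorCharacter_translate (χ : PontryaginDual G) (φ : characterSpace ℂ A) (t : G)
    (f : Lp A 1 m) : tensorCharacter (m := m) χ φ (translate t f) =
      starRingEnd ℂ (χ t : ℂ) * tensorCharacter (m := m) χ φ f := by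
  rw [tensorCharacter_apply, tensorCharacter_apply, fourierCLM_translate, map_smul, smul_eq_mul]

theorem norm_character_apply_le (φ : characterSpace ℂ A) (a : A) : ‖φ a‖ ≤ ‖(1 : A)‖ * ‖a‖ :=
  (CharacterSpace.toCLM φ).le_of_opNorm_le (CharacterSpace.norm_le_norm_one φ) a

theorem norm_tensorCharacter_apply_le (χ : PontryaginDual G) (φ : characterSpace ℂ A)
    (f : Lp A 1 m) : ‖tensorCharacter (m := m) χ φ f‖ ≤ ‖(1 : A)‖ * ‖f‖ := by
  rw [tensorCharacter_apply]
  exact (norm_character_apply_le φ _).trans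
    (mul_le_mul_of_nonneg_left (norm_fourierCLM_le χ f) (norm_nonneg _))

theorem smul_conv_left (a : A) (f g : Lp A 1 m) : conv (a • f) g = a • conv f g := by
  rw [← smulCLM_apply, ← smulCLM_apply, conv, conv,
    ← ContinuousLinearMap.integral_comp_comm _ (integrable_conv f g)]
  refine integral_congr_ae ?_
  filter_upwards [Lp.coeFn_smul a f] with t ht
  rw [smulCLM_apply, ht, Pi.smul_apply, smulCLM_apply, smul_assoc]

theorem smul_conv_right (a : A) (f g : Lp A 1 m) : conv f (a • g) = a • conv f g := by
  rw [← smulCLM_apply _ (conv f g), conv, conv,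
    ← ContinuousLinearMap.integral_comp_comm _ (integrable_conv f g)]
  refine integral_congr_ae (Filter.Eventually.of_forall fun t => ?_)
  change f t • translate t (a • g) = a • (f t • translate t g)
  rw [translate_smul, smul_comm]

theorem translate_conv_right (s : G) (f g : Lp A 1 m) :
    conv f (translate s g) = translate s (conv f g) := by
  rw [← translateCLM_apply _ (conv f g), conv, conv,
    ← ContinuousLinearMap.integral_comp_comm _ (integrable_conv f g)]
  refine integral_congr_ae (Filter.Eventually.of_forall fun t => ?_)
  change f t • translate t (translate s g) = translate s (f t • translate t g)
  rw [translate_smul, ← translate_mul, ← translate_mul, mul_comm]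

theorem translate_conv_left (s : G) (f g : Lp A 1 m) :
    conv (translate s f) g = translate s (conv f g) := by
  rw [← translate_conv_right, conv, conv,
    ← integral_mul_left_eq_self (μ := m) (fun t => f t • translate t (translate s g)) s⁻¹]
  refine integral_congr_ae ?_
  filter_upwards [translate_ae_eq s f] with t ht
  rw [ht, ← translate_mul, mul_right_comm, inv_mul_cancel, one_mul]

theorem norm_le_one_of_forall_norm_pow_le {z : ℂ} {M : ℝ} (h : ∀ n : ℕ, ‖z ^ n‖ ≤ M) : ‖z‖ ≤ 1 := by
  by_contra! hlt
  obtain ⟨n, hn⟩ := pow_unbounded_of_one_lt M hlt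
  exact absurd (h n) (by rw [norm_pow]; exact not_le.2 hn)

theorem translate_one (g : Lp A 1 m) : translate 1 g = g := by
  rw [translate_eq]
  simp

/-- With `ψ(e) = 1`, put `φ(a) = ψ(a • e)` and `conj χ(t) = ψ(e(t⁻¹ ·))`. Moving a scalar or a
translation from one convolution factor to the other shows that both are multiplicative, and `f ∗ e
= ∫ f(t) • e(t⁻¹ ·) dt` then determines `ψ`. -/
theorem exists_tensorCharacter_eq (ψ : characterSpace ℂ (L1 m A)) :
    ∃ (χ : PontryaginDual G) (φ : characterSpace ℂ A), tensorCharacter χ φ = ψ := by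
  obtain ⟨e, he⟩ : ∃ e : Lp A 1 m, ψ e = 1 := by
    obtain ⟨e₀, he₀⟩ : ∃ e₀ : L1 m A, ψ e₀ ≠ 0 := by
      by_contra! h
      exact ψ.2.1 (DFunLike.ext _ _ h)
    exact ⟨((ψ e₀)⁻¹ • e₀ : L1 m A), by rw [map_smul, smul_eq_mul, inv_mul_cancel₀ he₀]⟩
  have hconv : ∀ f g : Lp A 1 m, ψ (conv f g : Lp A 1 m) = ψ f * ψ g := fun f g =>
    ψ.2.2 f g
  have hsmul : ∀ (a : A) (f : Lp A 1 m), ψ (a • f : Lp A 1 m) = ψ (a • e : Lp A 1 m) * ψ f := by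
    intro a f
    rw [← hconv, smul_conv_left, ← smul_conv_right, hconv, he, one_mul]
  have htr : ∀ (t : G) (f : Lp A 1 m), ψ (translate t f) = ψ (translate t e) * ψ f := by
    intro t f
    rw [← hconv, translate_conv_left, ← translate_conv_right, hconv, he, one_mul]
  let L : Lp A 1 m →L[ℂ] ℂ := (CharacterSpace.toCLM ψ : L1 m A →L[ℂ] ℂ)
  have hL : ∀ f, L f = ψ f := fun _ => rfl
  let ι : A →L[ℂ] Lp A 1 m := LinearMap.mkContinuous
    { toFun := fun a => a • e
      map_add' := fun a b => add_smul a b e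
      map_smul' := fun c a => smul_assoc c a e } ‖e‖ fun a => by
        rw [mul_comm]; exact norm_smul_le a e
  let φ : characterSpace ℂ A := ⟨(L.comp ι : A →L[ℂ] ℂ), by
    refine ⟨fun h => one_ne_zero (α := ℂ) ?_, fun a b => ?_⟩
    · have h1 : ψ ((1 : A) • e : Lp A 1 m) = 0 := DFunLike.congr_fun h 1
      rw [← he, ← h1, one_smul]
    · change ψ ((a * b) • e : Lp A 1 m) = ψ (a • e : Lp A 1 m) * ψ (b • e : Lp A 1 m)
      rw [mul_smul, hsmul]⟩
  let θ : G → ℂ := fun t => ψ (translate t e)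
  have hθ1 : θ 1 = 1 := by
    change ψ (translate 1 e) = 1
    rw [translate_one, he]
  have hθmul : ∀ s t, θ (s * t) = θ s * θ t := fun s t => by
    change ψ (translate (s * t) e) = _
    rw [translate_mul, htr]
  have hθpow : ∀ (t : G) (n : ℕ), θ t ^ n = θ (t ^ n) := by
    intro t n
    induction n with
    | zero => simp [hθ1]
    | succ n ih => rw [pow_succ, ih, pow_succ, hθmul]
  -- All powers of `θ t` are values of `θ`, hence bounded by `‖L‖ * ‖e‖`, because translations are
  -- isometric. The reverse inequality comes from `θ t * θ t⁻¹ = 1`.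
  have hθle : ∀ t, ‖θ t‖ ≤ 1 := fun t => norm_le_one_of_forall_norm_pow_le (M := ‖L‖ * ‖e‖) fun n => by
    rw [hθpow, ← norm_translate (t ^ n) e]
    exact L.le_opNorm _
  have hθ : ∀ t, ‖θ t‖ = 1 := fun t => by
    refine le_antisymm (hθle t) ?_
    have h1 : ‖θ t‖ * ‖θ t⁻¹‖ = 1 := by
      rw [← norm_mul, ← hθmul, mul_inv_cancel, hθ1, norm_one]
    nlinarith [hθle t⁻¹, norm_nonneg (θ t)]
  have hθc : Continuous θ := L.continuous.comp (continuous_translate e)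
  have hmem : ∀ t, starRingEnd ℂ (θ t) ∈ Submonoid.unitSphere ℂ := fun t =>
    mem_sphere_zero_iff_norm.2 ((Complex.norm_conj _).trans (hθ t))
  let χ : PontryaginDual G :=
    ({ toFun := fun t => ⟨starRingEnd ℂ (θ t), hmem t⟩
       map_one' := by
          apply Subtype.ext
          change starRingEnd ℂ (θ 1) = 1
          rw [hθ1, map_one]
       map_mul' := fun s t => by
          apply Subtype.ext
          change starRingEnd ℂ (θ (s * t)) = starRingEnd ℂ (θ s) * starRingEnd ℂ (θ t)
          rw [hθmul, map_mul]
       continuous_toFun := (Complex.continuous_conj.comp hθc).subtype_mk hmem } : G →ₜ* Circle)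
  have hχ : ∀ t, (χ t : ℂ) = starRingEnd ℂ (θ t) := fun _ => rfl
  refine ⟨χ, φ, CharacterSpace.ext fun (f : Lp A 1 m) => ?_⟩
  have h1 : ψ f = ψ (conv f e : Lp A 1 m) := by
    rw [hconv, he, mul_one]
  refine (tensorCharacter_apply_eq_integral χ φ f).trans ?_
  rw [h1, ← hL, conv,
    ← ContinuousLinearMap.integral_comp_comm _ (integrable_conv f e)]
  refine integral_congr_ae (Filter.Eventually.of_forall fun t => ?_)
  change starRingEnd ℂ (χ t : ℂ) * ψ (f t • e : Lp A 1 m) = ψ (f t • translate t e : Lp A 1 m)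
  rw [hχ, Complex.conj_conj, hsmul (f t) (translate t e), mul_comm]

/-- At an `f` where the character is nonzero, its values on translates and on `A`-multiples of `f`
determine `χ` and `φ`. -/
theorem tensorCharacter_injective : Function.Injective
    fun p : PontryaginDual G × characterSpace ℂ A => tensorCharacter (m := m) p.1 p.2 := by
  rintro ⟨χ, φ⟩ ⟨χ', φ'⟩ h
  obtain ⟨f, hf'⟩ : ∃ f : Lp A 1 m, tensorCharacter (m := m) χ φ f ≠ 0 :=
    exists_tensorCLM_ne_zero m χ φ
  have h' : tensorCharacter (m := m) χ φ = tensorCharacter χ' φ' := h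
  refine Prod.ext ?_ ?_
  · refine PontryaginDual.ext fun t => ?_
    have h1 := tensorCharacter_translate χ φ t f
    rw [h', tensorCharacter_translate] at h1
    rw [h'] at hf'
    exact Subtype.ext ((starRingEnd ℂ).injective (mul_right_cancel₀ hf' h1).symm)
  · refine CharacterSpace.ext fun a => ?_
    have h1 := tensorCharacter_smul χ φ a f
    rw [h', tensorCharacter_smul] at h1
    rw [h'] at hf'
    exact (mul_right_cancel₀ hf' h1).symm

/-- The uniform bound makes the functionals equicontinuous, which upgrades separate continuity to
joint continuity. -/
theorem continuous_eval_of_norm_le {X B : Type*} [TopologicalSpace X] [NormedAddCommGroup B]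
    [NormedSpace ℂ B] {F : X → B →L[ℂ] ℂ} {C : ℝ} (hC : ∀ x b, ‖F x b‖ ≤ C * ‖b‖)
    (hF : ∀ b, Continuous fun x => F x b) : Continuous fun p : X × B => F p.1 p.2 := by
  rw [continuous_iff_continuousAt]
  rintro ⟨x₀, b₀⟩
  refine tendsto_iff_norm_sub_tendsto_zero.2 (squeeze_zero (fun _ => norm_nonneg _)
    (g := fun p : X × B => C * ‖p.2 - b₀‖ + ‖F p.1 b₀ - F x₀ b₀‖) (fun p => ?_) ?_)
  · have : F p.1 p.2 - F x₀ b₀ = F p.1 (p.2 - b₀) + (F p.1 b₀ - F x₀ b₀) := by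
      rw [map_sub]; ring
    rw [this]
    exact (norm_add_le _ _).trans (add_le_add (hC _ _) le_rfl)
  · have hc : Continuous fun p : X × B => C * ‖p.2 - b₀‖ + ‖F p.1 b₀ - F x₀ b₀‖ :=
      (continuous_const.mul (continuous_snd.sub continuous_const).norm).add
        (((hF b₀).comp continuous_fst).sub continuous_const).norm
    simpa using hc.tendsto (x₀, b₀)

theorem continuous_character_eval (f : L1 m A) :
    Continuous fun ψ : characterSpace ℂ (L1 m A) => ψ f :=
  (eval_continuous f).comp continuous_subtype_val

/-- The identification of `Ĝ × Δ(A)` with the character space of `L¹(G, A)`, as a bijection. -/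
def tensorEquiv (m : Measure G) [m.IsHaarMeasure] [m.Regular] (A : Type*) [NormedCommRing A]
    [NormedAlgebra ℂ A] [CompleteSpace A] :
    PontryaginDual G × characterSpace ℂ A ≃ characterSpace ℂ (L1 m A) :=
  Equiv.ofBijective (fun p => tensorCharacter p.1 p.2)
    ⟨tensorCharacter_injective, fun ψ =>
      let ⟨χ, φ, h⟩ := exists_tensorCharacter_eq ψ
      ⟨(χ, φ), h⟩⟩

theorem tensorCharacter_tensorEquiv_symm (ψ : characterSpace ℂ (L1 m A)) :
    tensorCharacter ((tensorEquiv m A).symm ψ).1 ((tensorEquiv m A).symm ψ).2 = ψ :=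
  (tensorEquiv m A).apply_symm_apply ψ

theorem continuous_tensorEquiv [T2Space G] : Continuous (tensorEquiv m A) := by
  refine Continuous.subtype_mk (WeakDual.continuous_of_continuous_eval fun f => ?_) _
  have h := continuous_eval_of_norm_le (F := fun φ : characterSpace ℂ A => CharacterSpace.toCLM φ)
    norm_character_apply_le fun a => (eval_continuous a).comp continuous_subtype_val
  exact h.comp (continuous_snd.prodMk
    ((continuous_fourierCLM (A := A) (m := m) f).comp continuous_fst))

/-- Near `ψ₀` with `ψ₀(e) ≠ 0` both components are quotients: `conj χ(t) = ψ(e(t⁻¹ ·)) / ψ(e)` and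
`φ(a) = ψ(a • e) / ψ(e)`. Joint continuity of the first in `(ψ, t)` gives continuity into the
compact-open topology. -/
theorem continuous_tensorEquiv_symm : Continuous (tensorEquiv m A).symm := by
  have hne : ∀ ψ : characterSpace ℂ (L1 m A), ∃ e : Lp A 1 m, ψ e ≠ 0 := fun ψ => by
    by_contra! h
    exact ψ.2.1 (DFunLike.ext _ _ h)
  have heval : Continuous fun p : characterSpace ℂ (L1 m A) × Lp A 1 m => p.1 p.2 := by
    refine continuous_eval_of_norm_le (B := Lp A 1 m)
      (F := fun ψ : characterSpace ℂ (L1 m A) => (CharacterSpace.toCLM ψ : L1 m A →L[ℂ] ℂ))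
      (C := ‖(1 : A)‖) (fun ψ f => ?_) fun f => continuous_character_eval (A := A) (m := m) f
    change ‖ψ f‖ ≤ _
    rw [← tensorCharacter_tensorEquiv_symm ψ]
    exact norm_tensorCharacter_apply_le _ _ f
  refine Continuous.prodMk ?_ ?_
  · refine ContinuousMonoidHom.continuous_of_continuous_uncurry (A := characterSpace ℂ (L1 m A))
      (fun ψ => (((tensorEquiv m A).symm ψ).1 : G →ₜ* Circle)) ?_
    refine Topology.IsInducing.subtypeVal.continuous_iff.2 (continuous_iff_continuousAt.2 ?_)
    rintro ⟨ψ₀, t₀⟩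
    obtain ⟨e, he⟩ := hne ψ₀
    have hc : ContinuousAt (fun p : characterSpace ℂ (L1 m A) × G =>
        starRingEnd ℂ (p.1 (translate p.2 e) / p.1 e))
        (ψ₀, t₀) := by
      refine Complex.continuous_conj.continuousAt.comp (ContinuousAt.div ?_ ?_ he)
      · exact (heval.comp (continuous_fst.prodMk
          ((continuous_translate e).comp continuous_snd))).continuousAt
      · exact ((continuous_character_eval (A := A) (m := m) e).comp continuous_fst).continuousAt
    refine hc.congr ?_
    have hev : ∀ᶠ p : characterSpace ℂ (L1 m A) × G in nhds (ψ₀, t₀), p.1 e ≠ 0 :=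
      ((continuous_character_eval (A := A) (m := m) e).comp
        continuous_fst).continuousAt.eventually_ne he
    filter_upwards [hev] with p hp
    have h1 := tensorCharacter_translate (m := m) ((tensorEquiv m A).symm p.1).1
      ((tensorEquiv m A).symm p.1).2 p.2 e
    rw [tensorCharacter_tensorEquiv_symm] at h1
    rw [h1, mul_div_cancel_right₀ _ hp,
      Complex.conj_conj]
    rfl
  · refine Continuous.subtype_mk (f := fun ψ => (((tensorEquiv m A).symm ψ).2 : WeakDual ℂ A))
      (WeakDual.continuous_of_continuous_eval fun a => ?_) fun ψ => ((tensorEquiv m A).symm ψ).2.2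
    refine continuous_iff_continuousAt.2 fun ψ₀ => ?_
    obtain ⟨e, he⟩ := hne ψ₀
    have hc : ContinuousAt (fun ψ : characterSpace ℂ (L1 m A) =>
        ψ (a • e : Lp A 1 m) / ψ e) ψ₀ :=
      (continuous_character_eval (A := A) (m := m) (a • e : Lp A 1 m)).continuousAt.div
        (continuous_character_eval (A := A) (m := m) e).continuousAt he
    refine hc.congr ?_
    filter_upwards [(continuous_character_eval (A := A) (m := m) e).continuousAt.eventually_ne he]
      with ψ hψ
    have h1 := tensorCharacter_smul (m := m) ((tensorEquiv m A).symm ψ).1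
      ((tensorEquiv m A).symm ψ).2 a e
    rw [tensorCharacter_tensorEquiv_symm] at h1
    rw [h1, mul_div_cancel_right₀ _ hψ]
    rfl

/-- The identification of `Ĝ × Δ(A)` with the character space of `L¹(G, A)`. -/
def tensorHomeomorph [T2Space G] (m : Measure G) [m.IsHaarMeasure] [m.Regular] (A : Type*)
    [NormedCommRing A] [NormedAlgebra ℂ A] [CompleteSpace A] :
    PontryaginDual G × characterSpace ℂ A ≃ₜ characterSpace ℂ (L1 m A) where
  toEquiv := tensorEquiv m A
  continuous_toFun := continuous_tensorEquiv
  continuous_invFun := continuous_tensorEquiv_symm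

end Characters

/-! ### BSE and BED inequalities for tensor products -/

section BSE

variable {G : Type*} [CommGroup G] [TopologicalSpace G] [IsTopologicalGroup G]
  [LocallyCompactSpace G] [MeasurableSpace G] [BorelSpace G]
  {m : Measure G} [m.IsHaarMeasure] [m.Regular]
  {A : Type*} [NormedCommRing A] [NormedAlgebra ℂ A] [CompleteSpace A]

theorem norm_sum_apply_le_norm_sum_tensorCharacter (m : Measure G) [m.IsHaarMeasure] [m.Regular]
    {n : ℕ} (c : Fin n → ℂ)
    (χ : Fin n → PontryaginDual G) (φ : Fin n → characterSpace ℂ A) (x : G) (a : A) :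
    ‖∑ i, c i * starRingEnd ℂ (χ i x : ℂ) * φ i a‖ ≤
      ‖∑ i, c i • CharacterSpace.toCLM (tensorCharacter (m := m) (χ i) (φ i))‖ * ‖a‖ := by
  set N := ‖∑ i, c i • CharacterSpace.toCLM (tensorCharacter (m := m) (χ i) (φ i))‖
  let p : G → ℂ := fun y => ∑ i, c i * starRingEnd ℂ (χ i y : ℂ) * φ i a
  have hp : Continuous p := continuous_finsetSum _ fun i _ =>
    (continuous_const.mul (continuous_conj_character (χ i))).mul continuous_const
  refine le_of_forall_pos_le_add fun ε hε => ?_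
  obtain ⟨S, hS, hm, hpos, h⟩ := exists_measurableSet_near m hp x hε
  have : IsFiniteMeasure (m.restrict S) := ⟨by simpa using lt_top_iff_ne_top.2 hm⟩
  have hi : ∀ i, Integrable (fun y => c i * starRingEnd ℂ (χ i y : ℂ) * φ i a) (m.restrict S) :=
    fun i => ((integrable_conj_character _ (χ i)).const_mul _).mul_const _
  have h1 := norm_setIntegral_sub_le hm (integrable_finsetSum _ fun i _ => hi i) _ h
  -- The integral of `p` over `S` is the value of the functional at `a • 1_S`, whose norm is `‖a‖
  -- m(S)`.
  have h2 : ∫ y in S, p y ∂m = (∑ i, c i • CharacterSpace.toCLM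
      (tensorCharacter (m := m) (χ i) (φ i))) (indicatorConstLp 1 hS hm a : Lp A 1 m) := by
    refine (integral_finsetSum _ fun i _ => hi i).trans (Eq.trans ?_ (sum_apply _ _ _).symm)
    refine Finset.sum_congr rfl fun i _ => ?_
    change _ = c i * φ i (fourierCLM m A (χ i) (indicatorConstLp 1 hS hm a))
    rw [fourierCLM_indicatorConstLp, map_smul, integral_mul_const, integral_const_mul, smul_eq_mul,
      mul_assoc]
  have h3 : ‖∫ y in S, p y ∂m‖ ≤ N * (‖a‖ * m.real S) := by
    rw [h2]
    refine (ContinuousLinearMap.le_opNorm _ _).trans (le_of_eq ?_)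
    congr 1
    have := norm_indicatorConstLp (p := 1) (hs := hS) (hμs := hm) (c := a) one_ne_zero
      ENNReal.one_ne_top
    simp only [ENNReal.toReal_one, div_one, Real.rpow_one] at this
    exact this
  have h4 : m.real S * ‖p x‖ ≤ m.real S * (N * ‖a‖ + ε) := by
    calc m.real S * ‖p x‖ = ‖∫ y in S, p y ∂m - (∫ y in S, p y ∂m - m.real S • p x)‖ := by
          rw [sub_sub_cancel, norm_smul, Real.norm_of_nonneg hpos.le]
      _ ≤ N * (‖a‖ * m.real S) + ε * m.real S := (norm_sub_le _ _).trans (add_le_add h3 h1)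
      _ = _ := by ring
  exact le_of_mul_le_mul_left h4 hpos

/-- The BSE inequality for `σ` is applied with the twisted coefficients `cᵢ conj χᵢ(x)`. The bound
does not depend on `x`, so it can later be integrated. -/
theorem norm_sum_mul_le (m : Measure G) [m.IsHaarMeasure] [m.Regular]
    {σ : characterSpace ℂ A → ℂ} {β : ℝ} (hβ : 0 ≤ β) {n : ℕ}
    {φ : Fin n → characterSpace ℂ A}
    (hσ : ∀ c : Fin n → ℂ, ‖∑ i, c i * σ (φ i)‖ ≤ β * ‖∑ i, c i • CharacterSpace.toCLM (φ i)‖)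
    (c : Fin n → ℂ) (χ : Fin n → PontryaginDual G) (x : G) :
    ‖∑ i, c i * σ (φ i) * starRingEnd ℂ (χ i x : ℂ)‖ ≤
      β * ‖∑ i, c i • CharacterSpace.toCLM (tensorCharacter (m := m) (χ i) (φ i))‖ := by
  have h1 := hσ fun i => c i * starRingEnd ℂ (χ i x : ℂ)
  simp only [mul_right_comm] at h1 ⊢
  refine h1.trans (mul_le_mul_of_nonneg_left ?_ hβ)
  refine ContinuousLinearMap.opNorm_le_bound _ (norm_nonneg _) fun a => ?_
  have h2 := norm_sum_apply_le_norm_sum_tensorCharacter m c χ φ x a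
  rw [sum_apply]
  exact h2

/-- If `u` is a bounded continuous function on `Ĝ` which is bounded by `M` as a functional on
trigonometric polynomials, then `u ⊗ σ` is a BSE function for every BSE function `σ`. -/
theorem IsBSE.tensor {u : PontryaginDual G → ℂ} (hu : Continuous u) {C : ℝ}
    (hC : ∀ χ, ‖u χ‖ ≤ C) {M : ℝ} (hM : 0 ≤ M)
    (h : ∀ (n : ℕ) (c : Fin n → ℂ) (χ : Fin n → PontryaginDual G) (D : ℝ),
      (∀ x, ‖∑ i, c i * starRingEnd ℂ (χ i x : ℂ)‖ ≤ D) → ‖∑ i, c i * u (χ i)‖ ≤ M * D)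
    {σ : characterSpace ℂ A → ℂ} (hσ : IsBSE σ) :
    IsBSE (fun ψ : characterSpace ℂ (L1 m A) =>
      u ((tensorEquiv m A).symm ψ).1 * σ ((tensorEquiv m A).symm ψ).2) := by
  obtain ⟨hc, ⟨D, hD⟩, β, hβ, hσβ⟩ := hσ
  refine ⟨(hu.comp (continuous_fst.comp continuous_tensorEquiv_symm)).mul
    (hc.comp (continuous_snd.comp continuous_tensorEquiv_symm)), ⟨C * D, fun ψ => ?_⟩,
    -- The summand 1 keeps the constant positive when `M = 0`.
    M * β + 1, by positivity, fun n c ψ => ?_⟩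
  · rw [norm_mul]
    exact mul_le_mul (hC _) (hD _) (norm_nonneg _) ((norm_nonneg _).trans (hC 1))
  · have h1 := h n (fun i => c i * σ ((tensorEquiv m A).symm (ψ i)).2)
      (fun i => ((tensorEquiv m A).symm (ψ i)).1) _
      (norm_sum_mul_le m hβ.le (fun c => hσβ n c fun i => ((tensorEquiv m A).symm (ψ i)).2) c
        fun i => ((tensorEquiv m A).symm (ψ i)).1)
    simp only [tensorCharacter_tensorEquiv_symm] at h1
    have e : ∀ i, c i * (u ((tensorEquiv m A).symm (ψ i)).1 * σ ((tensorEquiv m A).symm (ψ i)).2) =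
        c i * σ ((tensorEquiv m A).symm (ψ i)).2 * u ((tensorEquiv m A).symm (ψ i)).1 :=
      fun i => by ring
    simp only [e]
    refine h1.trans ?_
    rw [← mul_assoc]
    exact mul_le_mul_of_nonneg_right (by linarith) (norm_nonneg _)

theorem isBSE_fourierStieltjes_tensor [T2Space G] {μ : ComplexMeasure G} (hμ : IsRegularMeasure μ)
    {σ : characterSpace ℂ A → ℂ} (hσ : IsBSE σ) :
    IsBSE (fun ψ : characterSpace ℂ (L1 m A) =>
      fourierStieltjes μ ((tensorEquiv m A).symm ψ).1 * σ ((tensorEquiv m A).symm ψ).2) := by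
  refine IsBSE.tensor (continuous_fourierStieltjes hμ) (C := μ.variation.real Set.univ)
    (fun χ => ?_) measureReal_nonneg (fun n c χ D h => norm_sum_fourierStieltjes_le μ c χ h) hσ
  refine (norm_integral_complexMeasure_le μ _).trans (le_of_eq ?_)
  simp only [norm_conj_character, integral_const, smul_eq_mul, mul_one]

theorem norm_sum_fourier_le (f : Lp ℂ 1 m) {n : ℕ} (c : Fin n → ℂ)
    (χ : Fin n → PontryaginDual G) {D : ℝ}
    (h : ∀ x, ‖∑ i, c i * starRingEnd ℂ (χ i x : ℂ)‖ ≤ D) :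
    ‖∑ i, c i * fourierCLM m ℂ (χ i) f‖ ≤ ‖f‖ * D := by
  have hi := fun i => (integrable_character_smul (χ i) (L1.integrable_coeFn f)).const_mul (c i)
  have e : ∑ i, c i * fourierCLM m ℂ (χ i) f =
      ∫ x, (∑ i, c i * starRingEnd ℂ (χ i x : ℂ)) * f x ∂m := by
    simp only [fourierCLM_apply, Finset.sum_mul, ← integral_const_mul]
    rw [← integral_finsetSum _ fun i _ => hi i]
    simp only [smul_eq_mul, mul_assoc]
  rw [e, L1.norm_eq_integral_norm, ← integral_mul_const]
  refine norm_integral_le_of_norm_le ((L1.integrable_coeFn f).norm.mul_const D)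
    (Filter.Eventually.of_forall fun x => ?_)
  rw [norm_mul, mul_comm]
  exact mul_le_mul_of_nonneg_left (h x) (norm_nonneg _)

theorem isBSE_fourier_tensor [T2Space G] (f : Lp ℂ 1 m) {σ : characterSpace ℂ A → ℂ}
    (hσ : IsBSE σ) :
    IsBSE (fun ψ : characterSpace ℂ (L1 m A) =>
      fourierCLM m ℂ ((tensorEquiv m A).symm ψ).1 f * σ ((tensorEquiv m A).symm ψ).2) :=
  IsBSE.tensor (u := fun χ => fourierCLM m ℂ χ f) (continuous_fourierCLM f)
    (fun χ => norm_fourierCLM_le χ f) (norm_nonneg f)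
    (fun _ c χ _ h => norm_sum_fourier_le f c χ h) hσ

theorem isBED_fourier_tensor [T2Space G] {f : Lp ℂ 1 m}
    (hf : ∀ ε : ℝ, 0 < ε → ∃ (g : Lp ℂ 1 m) (K : Set (PontryaginDual G)), ‖f - g‖ ≤ ε ∧
      IsCompact K ∧ ∀ χ ∉ K, fourierCLM m ℂ χ g = 0)
    {σ : characterSpace ℂ A → ℂ} (hσ : IsBSE σ) :
    IsBED (fun ψ : characterSpace ℂ (L1 m A) =>
      fourierCLM m ℂ ((tensorEquiv m A).symm ψ).1 f * σ ((tensorEquiv m A).symm ψ).2) := by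
  refine ⟨isBSE_fourier_tensor f hσ, fun ε hε => ?_⟩
  obtain ⟨-, -, β, hβ, hσβ⟩ := hσ
  obtain ⟨g, K, hfg, hK, hg⟩ := hf (ε / β) (by positivity)
  -- Compactness of this set uses that the character space of the unital algebra `A` is compact;
  -- this is why BSE suffices for `σ`.
  refine ⟨tensorEquiv m A '' (K ×ˢ Set.univ), (hK.prod isCompact_univ).image
    continuous_tensorEquiv, fun n c ψ hψ => ?_⟩
  have hχ : ∀ i, ((tensorEquiv m A).symm (ψ i)).1 ∉ K := fun i hi =>
    hψ i ⟨(tensorEquiv m A).symm (ψ i), ⟨hi, Set.mem_univ _⟩, (tensorEquiv m A).apply_symm_apply _⟩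
  have h1 := norm_sum_fourier_le (f - g) (fun i => c i * σ ((tensorEquiv m A).symm (ψ i)).2)
    (fun i => ((tensorEquiv m A).symm (ψ i)).1)
    (norm_sum_mul_le m hβ.le (fun c => hσβ n c fun i => ((tensorEquiv m A).symm (ψ i)).2) c
      fun i => ((tensorEquiv m A).symm (ψ i)).1)
  simp only [tensorCharacter_tensorEquiv_symm] at h1
  have e : ∀ i, c i * (fourierCLM m ℂ ((tensorEquiv m A).symm (ψ i)).1 f *
      σ ((tensorEquiv m A).symm (ψ i)).2) = c i * σ ((tensorEquiv m A).symm (ψ i)).2 *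
        fourierCLM m ℂ ((tensorEquiv m A).symm (ψ i)).1 (f - g) := fun i => by
    rw [map_sub, hg _ (hχ i)]
    ring
  simp only [e]
  refine h1.trans ?_
  rw [← mul_assoc]
  refine mul_le_mul_of_nonneg_right ?_ (norm_nonneg _)
  rwa [le_div_iff₀ hβ] at hfg

end BSE

/-! ### Spectral cutoffs in C⋆-algebras -/

section CStarAlgebra

theorem cfc_complex (f : ℂ → ℂ) (z : ℂ) : cfc f z = f z :=
  cfc_algebraMap (A := ℂ) z f

/-- Characters commute with the functional calculus, so the Gelfand transform of the product
vanishes everywhere, and the Gelfand transform is injective. -/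
theorem star_cfc_mul_cfc_eq_zero {B : Type*} [CommCStarAlgebra B] {f : ℂ → ℂ} (hf : Continuous f)
    (a b : B) (h : ∀ θ : characterSpace ℂ B, f (θ a) = 0 ∨ f (θ b) = 0) :
    star (cfc f a) * cfc f b = 0 := by
  have hmap : ∀ (θ : characterSpace ℂ B) (c : B), θ (cfc f c) = f (θ c) := fun θ c => by
    rw [StarAlgHomClass.map_cfc (S := ℂ) θ f c hf.continuousOn (map_continuous θ)
      (IsStarNormal.mk (mul_comm _ _)) (IsStarNormal.mk (mul_comm _ _)), cfc_complex]
  refine (gelfandTransform_isometry B).injective ?_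
  rw [map_zero]
  ext θ
  change θ (star (cfc f a) * cfc f b) = 0
  rw [map_mul, map_star, hmap, hmap]
  rcases h θ with h | h <;> simp [h]

/-- The functional calculus is preserved by the inclusion of a closed star subalgebra, so only
characters of a commutative subalgebra containing `a` and `b` need testing. -/
theorem star_cfc_mul_cfc_eq_zero_of_starSubalgebra {R : Type*} [CStarAlgebra R]
    (S : StarSubalgebra ℂ R) (hS : IsClosed (S : Set R)) (hcomm : ∀ x ∈ S, ∀ y ∈ S, x * y = y * x)
    {f : ℂ → ℂ} (hf : Continuous f) (a b : S)
    (h : ∀ θ : S →ₐ[ℂ] ℂ, Continuous θ → f (θ a) = 0 ∨ f (θ b) = 0) :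
    star (cfc f (a : R)) * cfc f (b : R) = 0 := by
  have hcl : IsClosed (S : Set R) := hS
  let _ : CommCStarAlgebra S :=
    { (inferInstance : CStarAlgebra S) with
      mul_comm := fun x y => Subtype.ext (hcomm x x.2 y y.2) }
  have hmap : ∀ c : S, ((cfc f c : S) : R) = cfc f (c : R) := fun c =>
    StarAlgHom.map_cfc S.subtype f c hf.continuousOn continuous_subtype_val
      (IsStarNormal.mk (mul_comm _ _))
      (IsStarNormal.mk (hcomm _ (star_mem c.2) _ c.2))
  have h0 := star_cfc_mul_cfc_eq_zero hf a b fun θ =>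
    h (CharacterSpace.toAlgHom θ) (map_continuous θ)
  rw [← hmap, ← hmap]
  exact congrArg Subtype.val h0

/-- A continuous function which vanishes on the closed ball of radius `δ` and differs from the
identity by at most `δ`. -/
def cutoff (δ : ℝ) (z : ℂ) : ℂ := z - z * ((δ / max δ ‖z‖ : ℝ) : ℂ)

theorem continuous_cutoff {δ : ℝ} (hδ : 0 < δ) : Continuous (cutoff δ) := by
  unfold cutoff
  refine continuous_id.sub (continuous_id.mul (Complex.continuous_ofReal.comp ?_))
  exact continuous_const.div (continuous_const.max continuous_norm)
    fun z => (lt_max_of_lt_left hδ).ne'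

theorem cutoff_eq_zero {δ : ℝ} (hδ : 0 < δ) {z : ℂ} (hz : ‖z‖ ≤ δ) : cutoff δ z = 0 := by
  rw [cutoff, max_eq_left hz, div_self hδ.ne']
  simp

theorem norm_cutoff_sub_le {δ : ℝ} (hδ : 0 < δ) (z : ℂ) : ‖cutoff δ z - z‖ ≤ δ := by
  have h : 0 < max δ ‖z‖ := lt_max_of_lt_left hδ
  rw [cutoff, sub_sub_cancel_left, norm_neg, norm_mul, Complex.norm_real,
    Real.norm_of_nonneg (by positivity), mul_div_assoc', div_le_iff₀ h, mul_comm]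
  exact mul_le_mul_of_nonneg_left (le_max_right _ _) hδ.le

theorem norm_cfc_cutoff_sub_le {R : Type*} [CStarAlgebra R] {δ : ℝ} (hδ : 0 < δ) (a : R)
    [ha : IsStarNormal a] : ‖cfc (cutoff δ) a - a‖ ≤ δ := by
  have h := cfc_sub (cutoff δ) id a (continuous_cutoff hδ).continuousOn continuousOn_id
  rw [cfc_id ℂ a] at h
  rw [← h]
  exact norm_cfc_le hδ.le fun z _ => norm_cutoff_sub_le hδ z

end CStarAlgebra

/-! ### Convolution operators and translations on `L²(G)` -/

section RegularRepresentation

variable {G : Type*} [CommGroup G] [TopologicalSpace G] [IsTopologicalGroup G]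
  [LocallyCompactSpace G] [MeasurableSpace G] [BorelSpace G]
  {m : Measure G} [m.IsHaarMeasure] [m.Regular]

/-- Translation by `t` on `L²(G)`. -/
def regular (m : Measure G) [m.IsHaarMeasure] (t : G) : Lp ℂ 2 m →L[ℂ] Lp ℂ 2 m :=
  (Lp.compMeasurePreservingₗᵢ ℂ (fun x => t⁻¹ * x)
    (measurePreserving_mul_left m t⁻¹)).toContinuousLinearMap

theorem regular_eq (t : G) (g : Lp ℂ 2 m) : regular m t g = DomMulAct.mk t⁻¹ • g := rfl

theorem regular_ae_eq (t : G) (g : Lp ℂ 2 m) : regular m t g =ᵐ[m] fun x => g (t⁻¹ * x) :=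
  Lp.coeFn_compMeasurePreserving _ _

theorem norm_regular (t : G) (g : Lp ℂ 2 m) : ‖regular m t g‖ = ‖g‖ :=
  Lp.norm_compMeasurePreserving _ _

theorem regular_mul (s t : G) : regular m (s * t) = regular m s * regular m t := by
  ext1 g
  rw [mul_apply_eq_comp, regular_eq, regular_eq, regular_eq, smul_smul,
    ← DomMulAct.mk_mul]
  simp [mul_comm]

theorem regular_one : regular m (1 : G) = 1 := by
  ext1 g
  rw [regular_eq]
  simp

theorem continuous_regular (g : Lp ℂ 2 m) : Continuous fun t : G => regular m t g := by
  simp only [regular_eq]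
  have : Fact ((2 : ℝ≥0∞) ≠ ∞) := ⟨ENNReal.ofNat_ne_top⟩
  exact (DomMulAct.continuous_mk.comp continuous_inv).smul continuous_const

theorem star_regular (t : G) : star (regular m t) = regular m t⁻¹ := by
  rw [ContinuousLinearMap.star_eq_adjoint]
  symm
  rw [ContinuousLinearMap.eq_adjoint_iff]
  intro g h
  let V : Lp ℂ 2 m →ₗᵢ[ℂ] Lp ℂ 2 m := Lp.compMeasurePreservingₗᵢ ℂ (fun x => t⁻¹ * x)
    (measurePreserving_mul_left m t⁻¹)
  have h1 : inner ℂ (regular m t (regular m t⁻¹ g)) (regular m t h) =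
      inner ℂ (regular m t⁻¹ g) h :=
    V.inner_map_map _ _
  rw [← h1, ← mul_apply_eq_comp, ← regular_mul, mul_inv_cancel, regular_one]
  rfl

theorem aestronglyMeasurable_smul_continuous {V : Type*} [NormedAddCommGroup V] [NormedSpace ℂ V]
    (f : Lp ℂ 1 m) {F : G → V} (hF : Continuous F) :
    AEStronglyMeasurable (fun t => f t • F t) m := by
  have hf : StronglyMeasurable f := Lp.stronglyMeasurable f
  have hi : Integrable f m := L1.integrable_coeFn f
  let S : ℕ → Set G := fun n => {t | 1 / ((n : ℝ) + 1) ≤ ‖f t‖}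
  have hS : ∀ n, MeasurableSet (S n) := fun n =>
    measurableSet_le measurable_const hf.norm.measurable
  have hfin : ∀ n, m (S n) ≠ ∞ := fun n =>
    (hi.measure_norm_ge_lt_top (by positivity)).ne
  have h1 : AEStronglyMeasurable (fun t => f t • F t) (m.restrict (⋃ n, S n)) :=
    aestronglyMeasurable_iUnion_iff.2 fun n =>
      hf.aestronglyMeasurable.smul (aestronglyMeasurable_restrict hF (hS n) (hfin n))
  have h2 := (aestronglyMeasurable_indicator_iff (MeasurableSet.iUnion hS)).2 h1
  convert h2 using 1
  symm
  rw [Set.indicator_eq_self]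
  intro t ht
  have hne : f t ≠ 0 := fun h => ht (by simp [h])
  obtain ⟨n, hn⟩ := exists_nat_one_div_lt (norm_pos_iff.2 hne)
  exact Set.mem_iUnion.2 ⟨n, hn.le⟩

theorem integrable_regular (f : Lp ℂ 1 m) (g : Lp ℂ 2 m) :
    Integrable (fun t => f t • regular m t g) m := by
  refine ((L1.integrable_coeFn f).norm.mul_const ‖g‖).mono'
    (aestronglyMeasurable_smul_continuous f (continuous_regular g))
    (Filter.Eventually.of_forall fun t => ?_)
  rw [norm_smul, norm_regular]

/-- The operator `g ↦ f ∗ g` on `L²(G)`, for `f ∈ L¹(G)`. -/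
def convOp (f : Lp ℂ 1 m) : Lp ℂ 2 m →L[ℂ] Lp ℂ 2 m :=
  LinearMap.mkContinuous
    { toFun := fun g => ∫ t, f t • regular m t g ∂m
      map_add' := fun g h => by
        rw [← integral_add (integrable_regular f g) (integrable_regular f h)]
        simp only [map_add, smul_add]
      map_smul' := fun c g => by
        rw [RingHom.id_apply, ← integral_smul]
        simp only [map_smul, smul_comm c] } ‖f‖ fun g => by
    rw [L1.norm_eq_integral_norm f, ← integral_mul_const]
    refine norm_integral_le_of_norm_le ((L1.integrable_coeFn f).norm.mul_const _)
      (Filter.Eventually.of_forall fun t => ?_)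
    rw [norm_smul, norm_regular]

theorem convOp_apply (f : Lp ℂ 1 m) (g : Lp ℂ 2 m) :
    convOp f g = ∫ t, f t • regular m t g ∂m := rfl

theorem norm_convOp_le (f : Lp ℂ 1 m) : ‖convOp f‖ ≤ ‖f‖ :=
  LinearMap.mkContinuous_norm_le _ (norm_nonneg _) _

/-- The map `f ↦ (g ↦ f ∗ g)` from `L¹(G)` to the operators on `L²(G)`. -/
def convOpCLM (m : Measure G) [m.IsHaarMeasure] [m.Regular] :
    Lp ℂ 1 m →L[ℂ] (Lp ℂ 2 m →L[ℂ] Lp ℂ 2 m) :=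
  LinearMap.mkContinuous
    { toFun := convOp
      map_add' := fun f g => by
        ext1 h
        rw [add_apply, convOp_apply, convOp_apply, convOp_apply,
          ← integral_add (integrable_regular f h) (integrable_regular g h)]
        refine integral_congr_ae ?_
        filter_upwards [Lp.coeFn_add f g] with t ht
        rw [ht, Pi.add_apply, add_smul]
      map_smul' := fun c f => by
        ext1 h
        rw [RingHom.id_apply, smul_apply, convOp_apply, convOp_apply,
          ← integral_smul]
        refine integral_congr_ae ?_
        filter_upwards [Lp.coeFn_smul c f] with t ht
        rw [ht, Pi.smul_apply, smul_assoc] } 1 fun f => by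
    rw [one_mul]
    exact norm_convOp_le f

theorem convOpCLM_apply (f : Lp ℂ 1 m) : convOpCLM m f = convOp f := rfl

theorem regular_comm (s t : G) : regular m s * regular m t = regular m t * regular m s := by
  rw [← regular_mul, ← regular_mul, mul_comm]

theorem mul_convOp_of_commute {T : Lp ℂ 2 m →L[ℂ] Lp ℂ 2 m}
    (hT : ∀ t, T * regular m t = regular m t * T) (f : Lp ℂ 1 m) :
    T * convOp f = convOp f * T := by
  ext1 g
  rw [mul_apply_eq_comp, mul_apply_eq_comp, convOp_apply, convOp_apply,
    ← ContinuousLinearMap.integral_comp_comm T (integrable_regular f g)]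
  refine integral_congr_ae (Filter.Eventually.of_forall fun t => ?_)
  change T (f t • regular m t g) = f t • (regular m t * T) g
  rw [map_smul, ← hT]
  rfl

theorem convOp_translate (s : G) (f : Lp ℂ 1 m) :
    convOp (translate s f) = regular m s * convOp f := by
  rw [mul_convOp_of_commute fun t => regular_comm s t]
  ext1 g
  rw [mul_apply_eq_comp, convOp_apply, convOp_apply,
    ← integral_mul_left_eq_self (μ := m) (fun t => f t • regular m t (regular m s g)) s⁻¹]
  refine integral_congr_ae ?_
  filter_upwards [translate_ae_eq s f] with t ht
  rw [ht, ← mul_apply_eq_comp, ← regular_mul, mul_right_comm, inv_mul_cancel, one_mul]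

theorem convOp_conv (f g : Lp ℂ 1 m) : convOp (conv f g) = convOp f * convOp g := by
  ext1 h
  rw [← convOpCLM_apply, conv,
    ← ContinuousLinearMap.integral_comp_comm _ (integrable_conv f g),
    mul_apply_eq_comp, convOp_apply f]
  refine (ContinuousLinearMap.integral_apply
    (ContinuousLinearMap.integrable_comp (convOpCLM m) (integrable_conv f g)) h).trans ?_
  refine integral_congr_ae (Filter.Eventually.of_forall fun t => ?_)
  change convOpCLM m (f t • translate t g) h = f t • regular m t (convOp g h)
  rw [map_smul, convOpCLM_apply, convOp_translate]
  rfl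

/-- The von Neumann algebra generated by the translations of `L²(G)`. -/
def translationAlgebra (m : Measure G) [m.IsHaarMeasure] :
    StarSubalgebra ℂ (Lp ℂ 2 m →L[ℂ] Lp ℂ 2 m) :=
  StarSubalgebra.centralizer ℂ
    (StarSubalgebra.centralizer ℂ (Set.range (regular m)) : Set (Lp ℂ 2 m →L[ℂ] Lp ℂ 2 m))

theorem mem_centralizer_regular {T : Lp ℂ 2 m →L[ℂ] Lp ℂ 2 m} :
    T ∈ StarSubalgebra.centralizer ℂ (Set.range (regular m)) ↔
      ∀ t, T * regular m t = regular m t * T := by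
  rw [StarSubalgebra.mem_centralizer_iff]
  simp only [Set.forall_mem_range, star_regular]
  exact ⟨fun h t => (h t).1.symm, fun h t => ⟨(h t).symm, (h t⁻¹).symm⟩⟩

theorem isClosed_translationAlgebra :
    IsClosed (translationAlgebra m : Set (Lp ℂ 2 m →L[ℂ] Lp ℂ 2 m)) := by
  rw [translationAlgebra, StarSubalgebra.coe_centralizer]
  exact Set.isClosed_centralizer _

theorem mem_translationAlgebra {T : Lp ℂ 2 m →L[ℂ] Lp ℂ 2 m} :
    T ∈ translationAlgebra m ↔ ∀ V : Lp ℂ 2 m →L[ℂ] Lp ℂ 2 m,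
      (∀ t, V * regular m t = regular m t * V) → V * T = T * V := by
  rw [translationAlgebra, StarSubalgebra.mem_centralizer_iff]
  constructor
  · exact fun h V hV => (h V (mem_centralizer_regular.2 hV)).1
  · exact fun h V hV => ⟨h V (mem_centralizer_regular.1 hV),
      h _ (mem_centralizer_regular.1 (star_mem hV))⟩

/-- Translations commute with one another, so they lie in their own commutant. Hence the double
commutant is contained in the commutant, and its elements commute. -/
theorem translationAlgebra_comm {S T : Lp ℂ 2 m →L[ℂ] Lp ℂ 2 m} (hS : S ∈ translationAlgebra m)
    (hT : T ∈ translationAlgebra m) : S * T = T * S :=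
  mem_translationAlgebra.1 hT S fun t =>
    (mem_translationAlgebra.1 hS (regular m t) fun s => regular_comm t s).symm

theorem convOp_mem (f : Lp ℂ 1 m) : convOp f ∈ translationAlgebra m :=
  mem_translationAlgebra.2 fun _ hV => mul_convOp_of_commute hV f

instance isStarNormal_convOp (f : Lp ℂ 1 m) : IsStarNormal (convOp f) :=
  ⟨translationAlgebra_comm (star_mem (convOp_mem f)) (convOp_mem f)⟩

/-- A continuous character of the von Neumann algebra of translations is either zero on `L¹(G)`, or
evaluation of the Fourier transform at a character of `G`. -/
theorem algHom_convOp (θ : translationAlgebra m →ₐ[ℂ] ℂ) (hθ : Continuous θ) :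
    (∀ f : Lp ℂ 1 m, θ ⟨convOp f, convOp_mem f⟩ = 0) ∨
      ∃ η : PontryaginDual G, ∀ f : Lp ℂ 1 m,
        θ ⟨convOp f, convOp_mem f⟩ = fourierCLM m ℂ η f := by
  by_cases h0 : ∀ f : Lp ℂ 1 m, θ ⟨convOp f, convOp_mem f⟩ = 0
  · exact Or.inl h0
  right
  -- Composing `θ` with `f ↦ convOp f` gives a nonzero character of `L¹(G)`, so the classification
  -- of characters applies with `A = ℂ`.
  let L : Lp ℂ 1 m →L[ℂ] ℂ :=
    { toFun := fun f => θ ⟨convOp f, convOp_mem f⟩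
      map_add' := fun f g =>
        (congrArg θ (Subtype.ext (map_add (convOpCLM m) f g))).trans (θ.map_add' _ _)
      map_smul' := fun c f =>
        (congrArg θ (Subtype.ext (map_smul (convOpCLM m) c f))).trans
          (θ.toLinearMap.map_smul c ⟨convOp f, convOp_mem f⟩)
      cont := hθ.comp ((convOpCLM m).continuous.subtype_mk convOp_mem) }
  let ψ : characterSpace ℂ (L1 m ℂ) := ⟨(L : L1 m ℂ →L[ℂ] ℂ), by
    refine ⟨fun h => h0 fun f => DFunLike.congr_fun h f, fun f g => ?_⟩
    refine Eq.trans ?_ (θ.map_mul' _ _)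
    exact congrArg θ (Subtype.ext (convOp_conv f g))⟩
  obtain ⟨η, ω, h⟩ := exists_tensorCharacter_eq ψ
  refine ⟨η, fun f => ?_⟩
  have h1 : tensorCharacter η ω f = ψ f := by rw [h]
  have hω : ∀ z : ℂ, ω z = z := fun z => AlgHomClass.commutes ω z
  exact h1.symm.trans (hω _)

end RegularRepresentation

/-! ### Modulation, Riemann–Lebesgue and density of compactly supported transforms -/

section Density

variable {G : Type*} [CommGroup G] [TopologicalSpace G] [IsTopologicalGroup G]
  [LocallyCompactSpace G] [MeasurableSpace G] [BorelSpace G]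
  {m : Measure G} [m.IsHaarMeasure] [m.Regular]

theorem conj_mul_character (χ χ' : PontryaginDual G) (x : G) :
    starRingEnd ℂ ((χ * χ') x : ℂ) = starRingEnd ℂ (χ x : ℂ) * starRingEnd ℂ (χ' x : ℂ) :=
  map_mul (starRingEnd ℂ) (χ x : ℂ) (χ' x : ℂ)

theorem conj_mul_inv_character (χ : PontryaginDual G) (x : G) :
    starRingEnd ℂ (χ x : ℂ) * starRingEnd ℂ (χ⁻¹ x : ℂ) = 1 := by
  rw [← conj_mul_character, mul_inv_cancel]
  exact map_one (starRingEnd ℂ)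

theorem memLp_top_conj_character (m : Measure G) (χ : PontryaginDual G) :
    MemLp (fun x => starRingEnd ℂ (χ x : ℂ)) ∞ m :=
  memLp_top_of_bound (continuous_conj_character χ).measurable.aestronglyMeasurable 1
    (Filter.Eventually.of_forall fun x => (norm_conj_character χ x).le)

/-- Multiplication by `conj χ` on `Lᵖ(G)`. -/
def charMul (m : Measure G) (p : ℝ≥0∞) [Fact (1 ≤ p)] (χ : PontryaginDual G) :
    Lp ℂ p m →L[ℂ] Lp ℂ p m :=
  (ContinuousLinearMap.mul ℂ ℂ).holderL m ∞ p p ((memLp_top_conj_character m χ).toLp _)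

theorem charMul_ae_eq (p : ℝ≥0∞) [Fact (1 ≤ p)] (χ : PontryaginDual G) (g : Lp ℂ p m) :
    charMul m p χ g =ᵐ[m] fun x => starRingEnd ℂ (χ x : ℂ) * g x := by
  have h := (ContinuousLinearMap.mul ℂ ℂ).coeFn_holder (r := p)
    ((memLp_top_conj_character m χ).toLp _) g
  filter_upwards [h, (memLp_top_conj_character m χ).coeFn_toLp] with x h1 h2
  rw [← h2]
  exact h1

theorem charMul_mul_charMul_inv (p : ℝ≥0∞) [Fact (1 ≤ p)] (χ : PontryaginDual G) :
    charMul m p χ * charMul m p χ⁻¹ = 1 := by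
  ext1 g
  refine Lp.ext ?_
  filter_upwards [charMul_ae_eq p χ (charMul m p χ⁻¹ g), charMul_ae_eq p χ⁻¹ g] with x h1 h2
  refine h1.trans ?_
  rw [h2, ← mul_assoc, conj_mul_inv_character, one_mul]
  rfl

theorem star_charMul (χ : PontryaginDual G) : star (charMul m 2 χ) = charMul m 2 χ⁻¹ := by
  rw [ContinuousLinearMap.star_eq_adjoint]
  symm
  rw [ContinuousLinearMap.eq_adjoint_iff]
  intro g h
  rw [L2.inner_def, L2.inner_def]
  refine integral_congr_ae ?_
  filter_upwards [charMul_ae_eq 2 χ⁻¹ g, charMul_ae_eq 2 χ h] with x h1 h2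
  have h3 := conj_mul_inv_character χ x
  have h4 : (χ⁻¹ x : ℂ) = starRingEnd ℂ (χ x : ℂ) := by
    have h5 : starRingEnd ℂ (χ⁻¹ x : ℂ) * (χ⁻¹ x : ℂ) = 1 := by
      rw [mul_comm, Complex.mul_conj, Complex.normSq_eq_norm_sq]
      have := (Circle.norm_coe (χ⁻¹ x))
      simp [this]
    have h6 : starRingEnd ℂ (χ⁻¹ x : ℂ) ≠ 0 := left_ne_zero_of_mul_eq_one h5
    exact mul_right_cancel₀ h6 ((mul_comm _ _).trans (h5.trans h3.symm))
  rw [h1, h2, RCLike.inner_apply, RCLike.inner_apply, map_mul, Complex.conj_conj, h4]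
  ring

theorem charMul_mem_unitary (χ : PontryaginDual G) : charMul m 2 χ ∈ unitary
    (Lp ℂ 2 m →L[ℂ] Lp ℂ 2 m) := by
  have h := charMul_mul_charMul_inv (m := m) 2 χ⁻¹
  rw [inv_inv] at h
  exact ⟨by rw [star_charMul, h], by rw [star_charMul, charMul_mul_charMul_inv]⟩

theorem charMul_regular (χ : PontryaginDual G) (t : G) (g : Lp ℂ 2 m) :
    charMul m 2 χ (regular m t g) =
      starRingEnd ℂ (χ t : ℂ) • regular m t (charMul m 2 χ g) := by
  refine Lp.ext ?_
  have h0 := (measurePreserving_mul_left m t⁻¹).quasiMeasurePreserving.ae_eq_comp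
    (charMul_ae_eq 2 χ g)
  filter_upwards [charMul_ae_eq 2 χ (regular m t g), regular_ae_eq t g,
    Lp.coeFn_smul (starRingEnd ℂ (χ t : ℂ)) (regular m t (charMul m 2 χ g)),
    regular_ae_eq t (charMul m 2 χ g), h0] with x h1 h2 h3 h4 h5
  rw [h1, h2, h3, Pi.smul_apply, h4]
  refine Eq.trans ?_ (congrArg (fun z => starRingEnd ℂ (χ t : ℂ) • z) h5.symm)
  have h6 : starRingEnd ℂ (χ x : ℂ) =
      starRingEnd ℂ (χ t : ℂ) * starRingEnd ℂ (χ (t⁻¹ * x) : ℂ) := by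
    rw [← map_mul, ← Circle.coe_mul, ← map_mul, mul_inv_cancel_left]
  rw [h6, smul_eq_mul, mul_assoc]
  rfl

theorem charMul_mul_convOp (χ : PontryaginDual G) (f : Lp ℂ 1 m) :
    charMul m 2 χ * convOp f = convOp (charMul m 1 χ f) * charMul m 2 χ := by
  ext1 g
  rw [mul_apply_eq_comp, mul_apply_eq_comp, convOp_apply, convOp_apply,
    ← ContinuousLinearMap.integral_comp_comm _ (integrable_regular f g)]
  refine integral_congr_ae ?_
  filter_upwards [charMul_ae_eq 1 χ f] with t ht
  rw [ht, map_smul, charMul_regular, smul_smul, mul_comm]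

/-- Conjugation by the unitary `charMul m 2 χ` is a star automorphism taking convolution by `f` to
convolution by `conj χ · f`; it commutes with the functional calculus. -/
theorem cfc_convOp_charMul {φ : ℂ → ℂ} (hφ : Continuous φ) (χ : PontryaginDual G)
    (f : Lp ℂ 1 m) :
    charMul m 2 χ * cfc φ (convOp f) = cfc φ (convOp (charMul m 1 χ f)) * charMul m 2 χ := by
  let u : unitary (Lp ℂ 2 m →L[ℂ] Lp ℂ 2 m) := ⟨charMul m 2 χ, charMul_mem_unitary χ⟩
  have hu : star (charMul m 2 χ) * charMul m 2 χ = 1 := (charMul_mem_unitary χ).1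
  have hu' : charMul m 2 χ * star (charMul m 2 χ) = 1 := (charMul_mem_unitary χ).2
  have hconj : Unitary.conjStarAlgAut ℂ _ u (convOp f) = convOp (charMul m 1 χ f) := by
    change charMul m 2 χ * convOp f * star (charMul m 2 χ) = _
    rw [charMul_mul_convOp, mul_assoc, hu', mul_one]
  have hcont : Continuous (Unitary.conjStarAlgAut ℂ _ u) := by
    change Continuous fun x => charMul m 2 χ * x * star (charMul m 2 χ)
    fun_prop
  have h := StarAlgHomClass.map_cfc (S := ℂ) (Unitary.conjStarAlgAut ℂ _ u) φ (convOp f)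
    hφ.continuousOn hcont (isStarNormal_convOp f) (by rw [hconj]; exact isStarNormal_convOp _)
  rw [hconj] at h
  rw [← h]
  change _ = charMul m 2 χ * cfc φ (convOp f) * star (charMul m 2 χ) * charMul m 2 χ
  rw [mul_assoc _ (star (charMul m 2 χ)), hu, mul_one]

theorem fourierCLM_charMul (η χ : PontryaginDual G) (f : Lp ℂ 1 m) :
    fourierCLM m ℂ η (charMul m 1 χ f) = fourierCLM m ℂ (η * χ) f := by
  rw [fourierCLM_apply, fourierCLM_apply]
  refine integral_congr_ae ?_
  filter_upwards [charMul_ae_eq 1 χ f] with x hx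
  rw [hx, conj_mul_character, smul_eq_mul, smul_eq_mul, mul_assoc]

/-- The **Riemann–Lebesgue lemma**: Fourier transforms of integrable functions vanish at
infinity. -/
theorem exists_isCompact_norm_fourierCLM_le (f : Lp ℂ 1 m) {δ : ℝ} (hδ : 0 < δ) :
    ∃ K : Set (PontryaginDual G), IsCompact K ∧ ∀ χ ∉ K, ‖fourierCLM m ℂ χ f‖ ≤ δ := by
  -- Characters together with `0` form a weak-⋆ closed set, and `|ψ(f)| ≥ δ > 0` excludes `0`. Thus
  -- `S` is closed in a dual ball, hence compact by Banach–Alaoglu.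
  let S : Set (characterSpace ℂ (L1 m ℂ)) := {ψ | δ ≤ ‖ψ f‖}
  have himage : Subtype.val '' S = (characterSpace ℂ (L1 m ℂ) ∪ {0}) ∩
      {ψ : WeakDual ℂ (L1 m ℂ) | δ ≤ ‖ψ f‖} := by
    ext ψ
    constructor
    · rintro ⟨ψ, hψ, rfl⟩
      exact ⟨Or.inl ψ.2, hψ⟩
    · rintro ⟨hψ | hψ, h⟩
      · exact ⟨⟨ψ, hψ⟩, h, rfl⟩
      · rw [Set.mem_singleton_iff.1 hψ] at h
        refine absurd (h.trans (le_of_eq ?_)) (not_le.2 hδ)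
        exact norm_zero
  have hclosed : IsClosed (Subtype.val '' S) := by
    rw [himage]
    exact (CharacterSpace.union_zero_isClosed ℂ (L1 m ℂ)).inter
      (isClosed_le continuous_const (eval_continuous (f : L1 m ℂ)).norm)
  have hS : IsCompact S := by
    rw [Topology.IsInducing.subtypeVal.isCompact_iff]
    refine (WeakDual.isCompact_closedBall (𝕜 := ℂ) (E := L1 m ℂ) 0 ‖(1 : ℂ)‖).of_isClosed_subset
      hclosed ?_
    rintro _ ⟨ψ, -, rfl⟩
    rw [Set.mem_preimage, mem_closedBall_zero_iff]
    refine ContinuousLinearMap.opNorm_le_bound _ (norm_nonneg _) fun g => ?_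
    change ‖ψ g‖ ≤ _
    rw [← tensorCharacter_tensorEquiv_symm ψ]
    exact norm_tensorCharacter_apply_le _ _ g
  refine ⟨(fun ψ => ((tensorEquiv m ℂ).symm ψ).1) '' S,
    hS.image (continuous_fst.comp continuous_tensorEquiv_symm), fun χ hχ => ?_⟩
  by_contra! hlt
  obtain ⟨ω⟩ : Nonempty (characterSpace ℂ ℂ) := inferInstance
  have hω : ∀ z : ℂ, ω z = z := fun z => AlgHomClass.commutes ω z
  refine hχ ⟨tensorCharacter χ ω, ?_, ?_⟩
  · change δ ≤ ‖ω (fourierCLM m ℂ χ f)‖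
    rw [hω]
    exact hlt.le
  · exact congrArg Prod.fst ((tensorEquiv m ℂ).symm_apply_apply (χ, ω))

/-- A character of the translation algebra that is nonzero on `L¹(G)` sends the two convolutions to
`f̂(η)` and `f̂(ηχ)`. Both survive the cutoff only if `η` and `ηχ` lie in the Riemann–Lebesgue set
`K`, which forces `χ ∈ K⁻¹K`. -/
theorem exists_isCompact_star_cfc_mul_cfc_eq_zero (f : Lp ℂ 1 m) {δ : ℝ} (hδ : 0 < δ) :
    ∃ K : Set (PontryaginDual G), IsCompact K ∧ ∀ χ ∉ K,
      star (cfc (cutoff δ) (convOp f)) * cfc (cutoff δ) (convOp (charMul m 1 χ f)) = 0 := by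
  obtain ⟨K, hK, h⟩ := exists_isCompact_norm_fourierCLM_le f hδ
  refine ⟨(fun p : PontryaginDual G × PontryaginDual G => p.1⁻¹ * p.2) '' (K ×ˢ K),
    (hK.prod hK).image (continuous_fst.inv.mul continuous_snd), fun χ hχ => ?_⟩
  refine star_cfc_mul_cfc_eq_zero_of_starSubalgebra (translationAlgebra m)
    isClosed_translationAlgebra (fun x hx y hy => translationAlgebra_comm hx hy)
    (continuous_cutoff hδ) ⟨convOp f, convOp_mem f⟩ ⟨_, convOp_mem (charMul m 1 χ f)⟩
    fun θ hθ => ?_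
  rcases algHom_convOp θ hθ with h0 | ⟨η, hη⟩
  · left
    rw [h0]
    exact cutoff_eq_zero hδ (by rw [norm_zero]; exact hδ.le)
  · rw [hη, hη, fourierCLM_charMul]
    by_cases h1 : η ∈ K
    · right
      refine cutoff_eq_zero hδ (h _ fun h2 => hχ ⟨(η, η * χ), ⟨h1, h2⟩, ?_⟩)
      exact inv_mul_cancel_left η χ
    · exact Or.inl (cutoff_eq_zero hδ (h η h1))

/-- The pairing `(v, u) ↦ u * conj v` of `L²(G)` with itself, with values in `L¹(G)`. -/
def mulConj (m : Measure G) : Lp ℂ 2 m →L[ℝ] Lp ℂ 2 m →L[ℝ] Lp ℂ 1 m :=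
  ((ContinuousLinearMap.mul ℝ ℂ).comp (Complex.conjCLE : ℂ →L[ℝ] ℂ)).holderL m 2 2 1

theorem mulConj_ae_eq (v u : Lp ℂ 2 m) :
    mulConj m v u =ᵐ[m] fun x => starRingEnd ℂ (v x) * u x :=
  ((ContinuousLinearMap.mul ℝ ℂ).comp (Complex.conjCLE : ℂ →L[ℝ] ℂ)).coeFn_holder (r := 1) v u

theorem fourierCLM_mulConj (χ : PontryaginDual G) (v u : Lp ℂ 2 m) :
    fourierCLM m ℂ χ (mulConj m v u) = inner ℂ v (charMul m 2 χ u) := by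
  rw [L2.inner_def, fourierCLM_apply]
  refine integral_congr_ae ?_
  filter_upwards [mulConj_ae_eq v u, charMul_ae_eq 2 χ u] with x h1 h2
  rw [h1, h2, RCLike.inner_apply, smul_eq_mul]
  ring

/-- Take `v = √|f|` and `u = f / √|f|`, both of modulus `√|f|`; division by zero gives `u = 0` where
`f = 0`, as required. -/
theorem exists_mulConj_eq (f : Lp ℂ 1 m) : ∃ v u : Lp ℂ 2 m, mulConj m v u = f := by
  have hfm : StronglyMeasurable f := Lp.stronglyMeasurable f
  have hfi : Integrable f m := L1.integrable_coeFn f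
  have hs : Measurable fun x => ((√‖f x‖ : ℝ) : ℂ) :=
    Complex.measurable_ofReal.comp hfm.norm.measurable.sqrt
  have hv : MemLp (fun x => ((√‖f x‖ : ℝ) : ℂ)) 2 m := by
    rw [memLp_two_iff_integrable_sq_norm hs.aestronglyMeasurable]
    refine hfi.norm.congr (Filter.Eventually.of_forall fun x => ?_)
    simp only [Complex.norm_real, Real.norm_of_nonneg (Real.sqrt_nonneg _),
      Real.sq_sqrt (norm_nonneg _)]
  have hu : MemLp (fun x => f x / ((√‖f x‖ : ℝ) : ℂ)) 2 m := by
    have hq : Measurable fun x => f x / ((√‖f x‖ : ℝ) : ℂ) := hfm.measurable.div hs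
    rw [memLp_two_iff_integrable_sq_norm hq.aestronglyMeasurable]
    refine hfi.norm.congr (Filter.Eventually.of_forall fun x => ?_)
    simp only [norm_div, Complex.norm_real, Real.norm_of_nonneg (Real.sqrt_nonneg _),
      Real.div_sqrt, Real.sq_sqrt (norm_nonneg _)]
  refine ⟨hv.toLp _, hu.toLp _, Lp.ext ?_⟩
  filter_upwards [mulConj_ae_eq (hv.toLp _) (hu.toLp _), hv.coeFn_toLp, hu.coeFn_toLp]
    with x h1 h2 h3
  rw [h1, h2, h3, Complex.conj_ofReal]
  by_cases h0 : f x = 0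
  · simp [h0]
  · exact mul_div_cancel₀ _ (by simpa using h0)

theorem convOp_indicatorConstLp {S : Set G} (hS : MeasurableSet S) (hm : m S ≠ ∞) (c : ℂ)
    (g : Lp ℂ 2 m) :
    convOp (indicatorConstLp 1 hS hm c) g = c • ∫ t in S, regular m t g ∂m := by
  rw [convOp_apply, ← integral_indicator hS, ← integral_smul]
  refine integral_congr_ae ?_
  filter_upwards [indicatorConstLp_coeFn (p := 1) (hs := hS) (hμs := hm) (c := c)] with x hx
  rw [hx]
  by_cases h : x ∈ S <;> simp [h]

/-- The orbits of `v` and `u` under translation are continuous at `1`, so averaging translates over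
a small neighbourhood of `1` moves both vectors little. -/
theorem exists_norm_convOp_sub_le (m : Measure G) [m.IsHaarMeasure] [m.Regular]
    (v u : Lp ℂ 2 m) {ε : ℝ} (hε : 0 < ε) :
    ∃ f : Lp ℂ 1 m, ‖convOp f v - v‖ ≤ ε ∧ ‖convOp f u - u‖ ≤ ε := by
  obtain ⟨S, hS, hm, hpos, h⟩ := exists_measurableSet_near m
    ((continuous_regular v).prodMk (continuous_regular u)) 1 hε
  have key : ∀ g : Lp ℂ 2 m, (∀ y ∈ S, dist (regular m y g) g < ε) →
      ‖convOp (indicatorConstLp 1 hS hm ((m.real S : ℂ)⁻¹)) g - g‖ ≤ ε := by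
    intro g hg
    have hint : IntegrableOn (fun t => regular m t g) S m := by
      refine (integrableOn_const (C := ‖g‖) hm).mono'
        (aestronglyMeasurable_restrict (continuous_regular g) hS hm)
        (Filter.Eventually.of_forall fun t => (norm_regular t g).le)
    have h1 := norm_setIntegral_sub_le hm hint g hg
    have h2 : convOp (indicatorConstLp 1 hS hm ((m.real S : ℂ)⁻¹)) g - g =
        ((m.real S)⁻¹ : ℝ) • (∫ t in S, regular m t g ∂m - m.real S • g) := by
      rw [convOp_indicatorConstLp, smul_sub, inv_smul_smul₀ hpos.ne', ← Complex.ofReal_inv,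
        Complex.coe_smul]
      rfl
    rw [h2, norm_smul, norm_inv, Real.norm_of_nonneg hpos.le, inv_mul_le_iff₀ hpos, mul_comm]
    exact h1
  refine ⟨_, key v fun y hy => ?_, key u fun y hy => ?_⟩
  · have := (le_max_left _ _).trans_lt (h y hy)
    rw [regular_one] at this
    exact this
  · have := (le_max_right _ _).trans_lt (h y hy)
    rw [regular_one] at this
    exact this

theorem exists_norm_cfc_cutoff_sub_lt (m : Measure G) [m.IsHaarMeasure] [m.Regular]
    (v u : Lp ℂ 2 m) {ε : ℝ} (hε : 0 < ε) :
    ∃ (f : Lp ℂ 1 m) (δ : ℝ), 0 < δ ∧ ‖cfc (cutoff δ) (convOp f) v - v‖ < ε ∧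
      ‖cfc (cutoff δ) (convOp f) u - u‖ < ε := by
  obtain ⟨f, hv, hu⟩ := exists_norm_convOp_sub_le m v u (ε := ε / 3) (by positivity)
  have hM : 0 < ‖v‖ + ‖u‖ + 1 := by positivity
  -- The cutoff changes the operator by at most `δ` in norm; with this `δ` it moves `v` and `u` by
  -- at most `ε / 3`, in addition to the `ε / 3` from the averaging.
  have hδ : 0 < ε / (3 * (‖v‖ + ‖u‖ + 1)) := by positivity
  have key : ∀ g : Lp ℂ 2 m, ‖g‖ ≤ ‖v‖ + ‖u‖ + 1 → ‖convOp f g - g‖ ≤ ε / 3 →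
      ‖cfc (cutoff (ε / (3 * (‖v‖ + ‖u‖ + 1)))) (convOp f) g - g‖ < ε := by
    intro g hg hfg
    have h1 := ContinuousLinearMap.le_of_opNorm_le _ (norm_cfc_cutoff_sub_le hδ (convOp f)) g
    have h2 : ε / (3 * (‖v‖ + ‖u‖ + 1)) * ‖g‖ ≤ ε / 3 := by
      rw [div_mul_eq_mul_div, div_le_div_iff₀ (by positivity) (by positivity)]
      nlinarith
    have h3 := norm_add_le ((cfc (cutoff (ε / (3 * (‖v‖ + ‖u‖ + 1)))) (convOp f) - convOp f) g)
      (convOp f g - g)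
    rw [sub_apply, sub_add_sub_cancel] at h3
    rw [sub_apply] at h1
    linarith
  exact ⟨f, _, hδ, key v (by linarith [norm_nonneg u]) hv, key u (by linarith [norm_nonneg v]) hu⟩

/-- Functions whose Fourier transform has compact support are dense in `L¹(G)`. -/
theorem exists_fourierCLM_compactSupport (f : Lp ℂ 1 m) {ε : ℝ} (hε : 0 < ε) :
    ∃ (g : Lp ℂ 1 m) (K : Set (PontryaginDual G)), ‖f - g‖ ≤ ε ∧ IsCompact K ∧
      ∀ χ ∉ K, fourierCLM m ℂ χ g = 0 := by
  obtain ⟨v, u, rfl⟩ := exists_mulConj_eq f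
  have hc : Continuous fun p : Lp ℂ 2 m × Lp ℂ 2 m => mulConj m p.1 p.2 :=
    (mulConj m).continuous₂
  obtain ⟨r, hr, h⟩ := Metric.continuous_iff.1 hc (v, u) ε hε
  obtain ⟨f₀, δ, hδ, hv, hu⟩ := exists_norm_cfc_cutoff_sub_lt m v u hr
  obtain ⟨K, hK, hzero⟩ := exists_isCompact_star_cfc_mul_cfc_eq_zero f₀ hδ
  set T := cfc (cutoff δ) (convOp f₀)
  refine ⟨mulConj m (T v) (T u), K, ?_, hK, fun χ hχ => ?_⟩
  · rw [← dist_eq_norm, dist_comm]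
    refine (h (T v, T u) (max_lt ?_ ?_)).le
    · rwa [dist_eq_norm]
    · rwa [dist_eq_norm]
  -- The pairing `⟪T v, M_χ T u⟫`, with `M_χ` multiplication by `conj χ`, becomes `⟪v, T* T_χ M_χ
  -- u⟫` once `M_χ` is moved past `T`; the product `T* T_χ` is zero.
  · rw [fourierCLM_mulConj, ← mul_apply_eq_comp, cfc_convOp_charMul (continuous_cutoff hδ),
      ← ContinuousLinearMap.adjoint_inner_right, ← ContinuousLinearMap.star_eq_adjoint,
      ← mul_apply_eq_comp, ← mul_assoc, hzero χ hχ, zero_mul]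
    exact inner_zero_right _

end Density

end VectorGroupAlgebra

end

theorem mainTheorem7 {G : Type*} [CommGroup G] [TopologicalSpace G] [IsTopologicalGroup G]
    [LocallyCompactSpace G] [T2Space G] [MeasurableSpace G] [BorelSpace G]
    (m : Measure G) [m.IsHaarMeasure] [m.Regular]
    {A : Type*} [NormedCommRing A] [NormedAlgebra ℂ A] [CompleteSpace A]
    (hA : Ring.jacobson A = ⊥) :
    ∃ Φ : PontryaginDual G × characterSpace ℂ A ≃ₜ characterSpace ℂ (VectorGroupAlgebra.L1 m A),
      (∀ (χ : PontryaginDual G) (φ : characterSpace ℂ A) (f : VectorGroupAlgebra.L1 m A),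
        Φ (χ, φ) f = ∫ x, starRingEnd ℂ (χ x : ℂ) * φ (f x) ∂m) ∧
      (∀ μ : ComplexMeasure G, VectorGroupAlgebra.IsRegularMeasure μ →
        ∀ σ : characterSpace ℂ A → ℂ, VectorGroupAlgebra.IsBSE σ →
          VectorGroupAlgebra.IsBSE (fun ψ : characterSpace ℂ (VectorGroupAlgebra.L1 m A) =>
            VectorGroupAlgebra.fourierStieltjes μ (Φ.symm ψ).1 * σ (Φ.symm ψ).2)) ∧
      (∀ f : VectorGroupAlgebra.L1 m ℂ,
        ∀ σ : characterSpace ℂ A → ℂ, VectorGroupAlgebra.IsBED σ →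
          VectorGroupAlgebra.IsBED (fun ψ : characterSpace ℂ (VectorGroupAlgebra.L1 m A) =>
            VectorGroupAlgebra.fourier m f (Φ.symm ψ).1 * σ (Φ.symm ψ).2)) := by

  refine ⟨VectorGroupAlgebra.tensorHomeomorph m A, fun χ φ f => ?_, fun μ hμ σ hσ => ?_,
    fun f σ hσ => ?_⟩
  · exact VectorGroupAlgebra.tensorCharacter_apply_eq_integral χ φ f
  · exact VectorGroupAlgebra.isBSE_fourierStieltjes_tensor hμ hσ
  · exact VectorGroupAlgebra.isBED_fourier_tensor
      (fun _ hε => VectorGroupAlgebra.exists_fourierCLM_compactSupport f hε) hσ.1
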